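/- Let $\nu>0$, $k_0>0$ and $k_n=k_0 2^n$. Let $H$ be the Hilbert space of real sequences $u=(u_1,u_2,\dots)$ with $\sum_{n\ge1}u_n^2<\infty$ and $\langle u,v\rangle_H=\sum_n u_nv_n$, let $V=\{u\in H:\sum_n k_n^2u_n^2<\infty\}$, let $(Au)_n=k_n^2u_n$ with domain $D(A)=\{u\in H:\sum_n k_n^4u_n^2<\infty\}$, and for $u\in H$, $v\in V$ let $B(u,v)\in H$ be given by $(B(u,v))_n=k_{n-1}u_{n-1}v_{n-1}-k_nu_nv_{n+1}$ for $n\ge1$, with the convention $u_0=0$. Let $(\Omega,\mathcal F,(\mathcal F_t)_{t\ge0},P)$ be a filtered probability space and let $W$ be an $H$-valued Brownian motion on it with positive nuclear covariance operator $Q$; that is, $W$ is adapted, $W(0)=0$ a.s., its paths are a.s. continuous, and for $0\le s\le t$ the increment $W(t)-W(s)$ is independent of $\mathcal F_s$ and has law $N(0,(t-s)Q)$. Let $u_0:\Omega\to H$ be $\mathcal F_0$-measurable. Then the stochastic dyadic shell model $$du+\nu Au\,dt=B(u,u)\,dt+dW,\qquad u(0)=u_0,$$ has a global weak solution: there is a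 process $u=(u(t))_{t\ge0}$ with values in $H$ such that for every $T>0$ it is adapted to $(\mathcal F_t)$ on $[0,T]$, $u(0)=u_0$ a.s., $P$-a.s. $u\in C([0,T];H)$, and $P$-a.s., for all $\phi\in D(A)$ and all $t\in[0,T]$, $$\langle u(t),\phi\rangle_H+\nu\int_0^t\langle u(s),A\phi\rangle_H\,ds=\langle u_0,\phi\rangle_H-\int_0^t\langle B(u(s),\phi),u(s)\rangle_H\,ds+\langle W(t),\phi\rangle_H .$$ -/

import Mathlib

open MeasureTheory ProbabilityTheory
open scoped NNReal RealInnerProductSpace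

namespace DyadicShell

noncomputable section

/-- The Hilbert space `H` of real square-summable sequences `(u₁, u₂, u₃, …)`. The shell index
`n = 1, 2, …` is stored at position `n - 1`: the entry `u i` is the shell variable `u_{i+1}`. -/
abbrev H : Type := lp (fun _ : ℕ => ℝ) 2

/-- `H` carries its Borel `σ`-algebra. -/
instance instMeasurableSpaceH : MeasurableSpace H := borel H

instance instBorelSpaceH : BorelSpace H := ⟨rfl⟩

/-- The wave number `k_n = k₀ 2ⁿ`. -/
def wave (k₀ : ℝ) (n : ℕ) : ℝ := k₀ * 2 ^ n

lemma memH_iff {f : ℕ → ℝ} : Memℓp (E := fun _ : ℕ => ℝ) f 2 ↔ Summable fun i => f i ^ 2 := by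
  rw [memℓp_gen_iff (by simp)]
  simp

lemma summable_sq (u : H) : Summable fun i => u i ^ 2 := memH_iff.1 (lp.memℓp u)

/-- The space `V_s = {u ∈ H : ∑ k_n^{2s} u_n² < ∞}` for `s = 0, 1, 2, …`. -/
def Vs (k₀ : ℝ) (s : ℕ) : Submodule ℝ H where
  carrier := {u | Summable fun i => wave k₀ (i + 1) ^ (2 * s) * u i ^ 2}
  zero_mem' := by simp
  add_mem' := by
    intro u v hu hv
    refine Summable.of_nonneg_of_le (fun i => ?_) (fun i => ?_) ((hu.add hv).mul_left 2)
    · rw [pow_mul]; positivity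
    · have h : 0 ≤ wave k₀ (i + 1) ^ (2 * s) := by rw [pow_mul]; positivity
      have h2 : (u + v : H) i = u i + v i := rfl
      rw [h2]
      nlinarith [mul_nonneg h (sq_nonneg (u i - v i))]
  smul_mem' := by
    intro c u hu
    refine (hu.mul_left (c ^ 2)).congr fun i => ?_
    have h2 : (c • u : H) i = c * u i := rfl
    rw [h2]
    ring

/-- The space `V = V₁`. -/
abbrev V (k₀ : ℝ) : Submodule ℝ H := Vs k₀ 1

/-- The domain `D(A) = V₂ = {u : ∑ k_n⁴ u_n² < ∞}`. -/
abbrev DA (k₀ : ℝ) : Submodule ℝ H := Vs k₀ 2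

lemma DA_le_V (k₀ : ℝ) : DA k₀ ≤ V k₀ := by
  intro u hu
  refine Summable.of_nonneg_of_le (fun i => by rw [pow_mul]; positivity) (fun i => ?_)
    (Summable.add hu (summable_sq u))
  have h : wave k₀ (i + 1) ^ (2 * 1) ≤ wave k₀ (i + 1) ^ (2 * 2) + 1 := by
    generalize wave k₀ (i + 1) = x
    rw [pow_mul x 2 2, mul_one]
    nlinarith [sq_nonneg (x ^ 2 - 1), sq_nonneg x]
  nlinarith [mul_le_mul_of_nonneg_right h (sq_nonneg (u i))]

/-- The operator `A : D(A) ⊂ H → H`, `(A u)_n = k_n² u_n`. -/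
def opA (k₀ : ℝ) : H →ₗ.[ℝ] H where
  domain := DA k₀
  toFun :=
    { toFun := fun u => ⟨fun i => wave k₀ (i + 1) ^ 2 * (u : H) i, memH_iff.2 <|
        Summable.congr u.2 fun i => by ring⟩
      map_add' := by
        intro u v
        ext i
        exact mul_add _ _ _
      map_smul' := by
        intro c u
        ext i
        exact mul_left_comm _ _ _ }

/-- The sequence `(B(u,v))_n = k_{n-1} u_{n-1} v_{n-1} - k_n u_n v_{n+1}`, `n = 1, 2, …`, with the
boundary condition `u₀ = 0`. -/
def Bseq (k₀ : ℝ) (u v : ℕ → ℝ) : ℕ → ℝ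
  | 0 => -(wave k₀ 1 * u 0 * v 1)
  | i + 1 => wave k₀ (i + 1) * u i * v i - wave k₀ (i + 2) * u (i + 1) * v (i + 2)

lemma summable_Bseq_sq (k₀ : ℝ) (u : H) (v : V k₀) :
    Summable fun i => Bseq k₀ u (v : H) i ^ 2 := by
  have hv : Summable fun i => wave k₀ (i + 1) ^ (2 * 1) * (v : H) i ^ 2 := v.2
  have hb : ∀ i, u i ^ 2 ≤ ‖u‖ ^ 2 := fun i => by
    have := lp.norm_apply_le_norm two_ne_zero u i
    rw [← sq_abs (u i)]
    exact pow_le_pow_left₀ (abs_nonneg _) this 2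
  rw [← summable_nat_add_iff 1]
  refine Summable.of_nonneg_of_le (fun i => sq_nonneg _) (fun i => ?_)
    ((hv.add ((summable_nat_add_iff 2).2 hv)).mul_left (2 * ‖u‖ ^ 2))
  have hw : wave k₀ (i + 2) ^ 2 ≤ wave k₀ (i + 2 + 1) ^ 2 := by
    simp only [wave, pow_succ]
    nlinarith [sq_nonneg (k₀ * 2 ^ i)]
  have h1 := mul_le_mul_of_nonneg_right (hb i) (sq_nonneg (wave k₀ (i + 1) * (v : H) i))
  have h2 := mul_le_mul_of_nonneg_right (hb (i + 1))
    (sq_nonneg (wave k₀ (i + 2) * (v : H) (i + 2)))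
  have h3 := mul_le_mul_of_nonneg_left hw
    (mul_nonneg (sq_nonneg ‖u‖) (sq_nonneg ((v : H) (i + 2))))
  have h4 := sq_nonneg (wave k₀ (i + 1) * u i * (v : H) i +
    wave k₀ (i + 2) * u (i + 1) * (v : H) (i + 2))
  simp only [Bseq, mul_one]
  generalize u i = a, u (i + 1) = b, (v : H) i = c, (v : H) (i + 2) = d at *
  nlinarith

/-- The bilinear operator `B : H × V → H`. -/
def opB (k₀ : ℝ) (u : H) (v : V k₀) : H :=
  ⟨Bseq k₀ u (v : H), memH_iff.2 (summable_Bseq_sq k₀ u v)⟩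

/-- The antisymmetry `⟨B(u,v), w⟩_{V' × V} = -⟨B(u,w), v⟩_H` for `u, v ∈ H` and `w ∈ V`, where the
left side is the pairing `∑ (B(u,v))_n w_n`. With `v = u` it turns `⟨B(u,u), φ⟩` into
`-⟨B(u,φ), u⟩`, which is the nonlinear term of the weak formulation below. -/
lemma hasSum_Bseq_mul (k₀ : ℝ) (u v : H) (w : V k₀) :
    HasSum (fun i => Bseq k₀ u v i * (w : H) i) (-⟪opB k₀ u w, v⟫) := by
  have hw : Summable fun i => wave k₀ (i + 1) ^ (2 * 1) * (w : H) i ^ 2 := w.2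
  have hv := summable_sq v
  have hb : ∀ i, |u i| ≤ ‖u‖ := fun i => lp.norm_apply_le_norm two_ne_zero u i
  have key : ∀ c x y z : ℝ, |x| ≤ ‖u‖ →
      |c * x * y * z| ≤ ‖u‖ * (y ^ 2 + c ^ (2 * 1) * z ^ 2) := fun c x y z hx => by
    have h : |y * (c * z)| ≤ y ^ 2 + c ^ (2 * 1) * z ^ 2 := by
      rw [abs_le, mul_one]
      constructor <;> nlinarith [sq_nonneg (y + c * z), sq_nonneg (y - c * z)]
    have e : c * x * y * z = x * (y * (c * z)) := by ring
    rw [e, abs_mul]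
    exact mul_le_mul hx h (abs_nonneg _) (norm_nonneg _)
  have hp : Summable fun i => wave k₀ (i + 1) * u i * v i * (w : H) (i + 1) := by
    refine Summable.of_norm_bounded ((hv.add ((summable_nat_add_iff 1).2 hw)).mul_left ‖u‖)
      fun i => ?_
    refine (key _ _ _ _ (hb i)).trans (mul_le_mul_of_nonneg_left ?_ (norm_nonneg _))
    have hk : wave k₀ (i + 1) ^ 2 ≤ wave k₀ (i + 1 + 1) ^ 2 := by
      simp only [wave, pow_succ]
      nlinarith [sq_nonneg (k₀ * 2 ^ i)]
    have := mul_le_mul_of_nonneg_right hk (sq_nonneg ((w : H) (i + 1)))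
    simpa using this
  have hq : Summable fun i => wave k₀ (i + 1) * u i * v (i + 1) * (w : H) i :=
    Summable.of_norm_bounded ((((summable_nat_add_iff 1).2 hv).add hw).mul_left ‖u‖)
      fun i => key _ _ _ _ (hb i)
  have shift : ∀ (f : ℕ → ℝ) (a : ℝ), f 0 = 0 → HasSum (fun i => f (i + 1)) a → HasSum f a :=
    fun f a h0 h => by simpa [h0] using (hasSum_nat_add_iff 1).1 h
  have cg : ∀ {f g : ℕ → ℝ} {a : ℝ}, (∀ i, f i = g i) → HasSum f a → HasSum g a :=
    fun h hf => (funext h) ▸ hf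
  have hI : HasSum (fun i => Bseq k₀ u (w : H) i * v i) ⟪opB k₀ u w, v⟫ := by
    refine cg (fun i => ?_) (lp.hasSum_inner (𝕜 := ℝ) (opB k₀ u w) v)
    exact mul_comm _ _
  have h1 : HasSum (fun i => Bseq k₀ u v i * (w : H) i)
      ((∑' i, wave k₀ (i + 1) * u i * v i * (w : H) (i + 1)) -
        ∑' i, wave k₀ (i + 1) * u i * v (i + 1) * (w : H) i) := by
    have := (shift (fun i => Bseq k₀ u v i * (w : H) i +
      wave k₀ (i + 1) * u i * v (i + 1) * (w : H) i) _ (by simp only [Bseq]; ring_nf)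
      (cg (fun i => by simp only [Bseq]; ring) hp.hasSum)).sub hq.hasSum
    exact cg (fun i => by ring) this
  have h2 : HasSum (fun i => Bseq k₀ u (w : H) i * v i)
      ((∑' i, wave k₀ (i + 1) * u i * v (i + 1) * (w : H) i) -
        ∑' i, wave k₀ (i + 1) * u i * v i * (w : H) (i + 1)) := by
    have := (shift (fun i => Bseq k₀ u (w : H) i * v i +
      wave k₀ (i + 1) * u i * v i * (w : H) (i + 1)) _ (by simp only [Bseq]; ring_nf)
      (cg (fun i => by simp only [Bseq]; ring) hq.hasSum)).sub hp.hasSum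
    exact cg (fun i => by ring) this
  rw [hI.unique h2, neg_sub]
  exact h1

/-- A bounded operator on `H` is nuclear if `Q x = ∑ ⟨a_j, x⟩ b_j` with
`∑ ‖a_j‖ ‖b_j‖ < ∞`. -/
def IsNuclear (Q : H →L[ℝ] H) : Prop :=
  ∃ a b : ℕ → H, Summable (fun j => ‖a j‖ * ‖b j‖) ∧ ∀ x, HasSum (fun j => ⟪a j, x⟫ • b j) (Q x)

/-- `W` is an `H`-valued Brownian motion with (positive, nuclear) covariance operator `Q` on the
filtered probability space `(Ω, ℱ, P)`. The law of `W t - W s` is the centered Gaussian measure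
`N(0, (t - s) Q)`, expressed through its one-dimensional projections, which determine it. -/
structure IsQWiener {Ω : Type*} {mΩ : MeasurableSpace Ω} (P : Measure Ω)
    (ℱ : Filtration ℝ≥0 mΩ) (Q : H →L[ℝ] H) (W : ℝ≥0 → Ω → H) : Prop where
  isPositive : Q.IsPositive
  isNuclear : IsNuclear Q
  adapted : Adapted ℱ W
  zero : ∀ᵐ ω ∂P, W 0 ω = 0
  continuous : ∀ᵐ ω ∂P, Continuous fun t => W t ω
  indep : ∀ s t : ℝ≥0, s ≤ t →
    Indep (MeasurableSpace.comap (fun ω => W t ω - W s ω) inferInstance) (ℱ s) P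
  hasLaw : ∀ s t : ℝ≥0, s ≤ t → ∀ x : H,
    HasLaw (fun ω => ⟪W t ω - W s ω, x⟫) (gaussianReal 0 ((t - s) * ⟪Q x, x⟫.toNNReal)) P

/-- `u` is a weak solution on `[0, T]` of `du + ν A u dt = B(u,u) dt + dW`, `u(0) = u₀`: it is
adapted, almost surely has paths in `C([0,T]; H)`, and almost surely satisfies, for all
`φ ∈ D(A)` and `t ∈ [0, T]`,
`⟨u(t), φ⟩ + ν ∫₀ᵗ ⟨u(s), Aφ⟩ ds = ⟨u₀, φ⟩ - ∫₀ᵗ ⟨B(u(s), φ), u(s)⟩ ds + ⟨W(t), φ⟩`. -/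
structure IsWeakSolutionOn {Ω : Type*} {mΩ : MeasurableSpace Ω} (P : Measure Ω)
    (ℱ : Filtration ℝ≥0 mΩ) (k₀ ν : ℝ) (W : ℝ≥0 → Ω → H) (u₀ : Ω → H) (T : ℝ≥0)
    (u : ℝ≥0 → Ω → H) : Prop where
  adapted : ∀ t ≤ T, Measurable[ℱ t] (u t)
  initial : ∀ᵐ ω ∂P, u 0 ω = u₀ ω
  continuousOn : ∀ᵐ ω ∂P, ContinuousOn (fun t => u t ω) (Set.Icc 0 T)
  weak_eq : ∀ᵐ ω ∂P, ∀ φ : DA k₀, ∀ t ≤ T,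
    ⟪u t ω, (φ : H)⟫ + ν * ∫ s in (0 : ℝ)..t, ⟪u s.toNNReal ω, opA k₀ φ⟫ =
      ⟪u₀ ω, (φ : H)⟫
        - (∫ s in (0 : ℝ)..t,
            ⟪opB k₀ (u s.toNNReal ω) (Submodule.inclusion (DA_le_V k₀) φ), u s.toNNReal ω⟫)
        + ⟪W t ω, (φ : H)⟫

/-- A global weak solution is one process on `[0, ∞)` which is a weak solution on `[0, T]` for
every `T > 0`. -/
def IsGlobalWeakSolution {Ω : Type*} {mΩ : MeasurableSpace Ω} (P : Measure Ω)
    (ℱ : Filtration ℝ≥0 mΩ) (k₀ ν : ℝ) (W : ℝ≥0 → Ω → H) (u₀ : Ω → H)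
    (u : ℝ≥0 → Ω → H) : Prop :=
  ∀ T : ℝ≥0, 0 < T → IsWeakSolutionOn P ℱ k₀ ν W u₀ T u

end

end DyadicShell

/-! The equation is solved path by path, without stochastic integrals. The nonlinearity has the form
`B = A^{1/2} bil` with `bil` bounded and bilinear on `H`, and the semigroup recovers the lost half
power of `A`: the map `f ↦ ∫₀ᵗ A^{1/2} e^{-ν(t-s)A} f(s) ds` has norm squared at most `(2ν)⁻¹ ∫₀ᵗ
‖f‖²` (`norm_smoothing_sq_le`). With `bil` truncated at radius `R` the drift is Lipschitz, and
Picard iteration solves the mild equation.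

The noise enters through `z = ouPath`, the stochastic convolution integrated by parts in time in
each shell. It is continuous in `H` once `∑ sup w_n² < ∞`; `IsQWiener.ae_exists_summable_bound` gets
this from the finite trace of `Q` by dyadic chaining with fourth moments.

To remove the truncation, consider `v = u - z`, whose shells are differentiable. The sum `⟨B(u,v),
v⟩` telescopes to a flux that vanishes in the limit, and the dissipation absorbs `⟨B(u,z), v⟩`. Thus
`energy_le` and Gronwall bound `u` on `[0,T]` independently of `R`, so for large `R` the truncation
is inactive and the solutions coincide (`exists_truncSol_stable`).

Adaptedness holds because every approximation at time `t` depends measurably on the noise up to `t`.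
The exceptional null set need not belong to `ℱ t`; the solution is built off it and then extended
measurably. -/

open Filter Topology

namespace DyadicShell

noncomputable section

/-! ### Coordinates, continuity and measurability in `H`. -/

section SequenceSpace

open Classical in
/-- The sequence `f` as an element of `H`, or `0` if `f` is not square summable. -/
def toH (f : ℕ → ℝ) : H := if h : Memℓp (E := fun _ : ℕ => ℝ) f 2 then ⟨f, h⟩ else 0

lemma toH_apply {f : ℕ → ℝ} (h : Summable fun i => f i ^ 2) (n : ℕ) : toH f n = f n := by
  rw [toH, dif_pos (memH_iff.2 h)]

lemma H.add_apply (u v : H) (n : ℕ) : (u + v) n = u n + v n := rfl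

lemma H.sub_apply (u v : H) (n : ℕ) : (u - v) n = u n - v n := rfl

lemma H.smul_apply (c : ℝ) (u : H) (n : ℕ) : (c • u) n = c * u n := rfl

lemma hasSum_norm_sq (u : H) : HasSum (fun i => u i ^ 2) (‖u‖ ^ 2) := by
  have h := lp.hasSum_norm (p := 2) (E := fun _ : ℕ => ℝ) (by simp) u
  simpa using h

lemma sum_range_sq_le (u : H) (N : ℕ) : ∑ i ∈ Finset.range N, u i ^ 2 ≤ ‖u‖ ^ 2 :=
  sum_le_hasSum _ (fun i _ => sq_nonneg (u i)) (hasSum_norm_sq u)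

lemma sum_range_shift_sq_le (u : H) (m N : ℕ) :
    ∑ i ∈ Finset.range N, u (i + m) ^ 2 ≤ ‖u‖ ^ 2 := by
  refine le_trans ?_ (sum_range_sq_le u (m + N))
  rw [Finset.sum_range_add]
  simp_rw [add_comm _ m]
  exact le_add_of_nonneg_left (Finset.sum_nonneg fun i _ => sq_nonneg _)

lemma abs_apply_le_norm (u : H) (n : ℕ) : |u n| ≤ ‖u‖ := lp.norm_apply_le_norm two_ne_zero u n

lemma sq_apply_le_norm_sq (u : H) (n : ℕ) : u n ^ 2 ≤ ‖u‖ ^ 2 := by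
  rw [← sq_abs (u n)]
  exact pow_le_pow_left₀ (abs_nonneg _) (abs_apply_le_norm u n) 2

lemma norm_sq_le_of_sum_range_le {u : H} {c : ℝ}
    (h : ∀ N, ∑ i ∈ Finset.range N, u i ^ 2 ≤ c) : ‖u‖ ^ 2 ≤ c :=
  le_of_tendsto' (hasSum_norm_sq u).tendsto_sum_nat h

lemma tendsto_apply_zero (u : H) : Tendsto (fun n => u n) atTop (𝓝 0) := by
  have h := (summable_sq u).tendsto_atTop_zero
  have h2 := (Real.continuous_sqrt.tendsto 0).comp h
  simp only [Real.sqrt_zero] at h2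
  rw [tendsto_zero_iff_abs_tendsto_zero]
  refine h2.congr fun n => ?_
  simp [Function.comp, Real.sqrt_sq_eq_abs]

/-- The `n`-th basis vector of `H`. -/
def basisVec (n : ℕ) : H := lp.single 2 n (1 : ℝ)

lemma inner_basisVec (u : H) (n : ℕ) : ⟪u, basisVec n⟫ = u n := by
  rw [basisVec, lp.inner_single_right]
  simp

lemma continuous_apply (n : ℕ) : Continuous fun u : H => u n := by
  simp_rw [← inner_basisVec]
  fun_prop

lemma hasSum_inner_mul (u v : H) : HasSum (fun i => u i * v i) ⟪u, v⟫ := by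
  have e : (fun i => u i * v i) = fun i => ⟪u i, v i⟫ := funext fun i => mul_comm (u i) (v i)
  rw [e]
  exact lp.hasSum_inner (𝕜 := ℝ) u v

lemma hasSum_smul_basisVec (u : H) : HasSum (fun i => u i • basisVec i) u := by
  have h := lp.hasSum_single (p := 2) (E := fun _ : ℕ => ℝ) (by simp) u
  convert h using 2 with i
  rw [basisVec, ← lp.single_smul]
  simp

/-- A map into `H` is continuous at a point if its coordinates are, and if near that point its
coordinates are dominated by a fixed square summable sequence. -/
lemma continuousAt_of_apply {X : Type*} [TopologicalSpace X] {f : X → H} {x : X}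
    (hf : ∀ n, ContinuousAt (fun y => f y n) x) {a : ℕ → ℝ} (ha : Summable a)
    (hb : ∀ᶠ y in 𝓝 x, ∀ n, f y n ^ 2 ≤ a n) : ContinuousAt f x := by
  have hx := hb.self_of_nhds
  -- Dominated convergence for series: `(a - b)² ≤ 2a² + 2b²` gives the dominating sequence `4 a n`.
  have key : Tendsto (fun y => ∑' n, (f y n - f x n) ^ 2) (𝓝 x) (𝓝 (∑' _ : ℕ, (0 : ℝ))) := by
    refine tendsto_tsum_of_dominated_convergence (bound := fun n => 4 * a n) (ha.mul_left 4)
      (fun n => ?_) ?_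
    · have h : Tendsto (fun y => (f y n - f x n) ^ 2) (𝓝 x) (𝓝 ((f x n - f x n) ^ 2)) :=
        ((hf n).sub continuousAt_const).pow 2
      simpa using h
    · filter_upwards [hb] with y hy n
      rw [Real.norm_eq_abs, abs_of_nonneg (sq_nonneg _)]
      nlinarith [hy n, hx n, sq_nonneg (f y n + f x n)]
  have e : ∀ y, ∑' n, (f y n - f x n) ^ 2 = ‖f y - f x‖ ^ 2 := fun y =>
    (hasSum_norm_sq (f y - f x)).tsum_eq
  simp only [e, tsum_zero] at key
  rw [ContinuousAt, tendsto_iff_norm_sub_tendsto_zero]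
  have h2 := (Real.continuous_sqrt.tendsto 0).comp key
  simpa [Function.comp_def] using h2

/-- Each value is the limit of its finite coordinate sums, so measurability can be checked one shell
at a time. -/
lemma stronglyMeasurable_of_apply {Ω : Type*} {m : MeasurableSpace Ω} {f : Ω → H}
    (hf : ∀ n, Measurable fun ω => f ω n) : StronglyMeasurable f := by
  refine stronglyMeasurable_of_tendsto (u := atTop)
    (f := fun (N : ℕ) ω => ∑ i ∈ Finset.range N, f ω i • basisVec i) (fun N => ?_) ?_
  · exact Finset.stronglyMeasurable_fun_sum _ fun i _ =>
      (hf i).stronglyMeasurable.smul_const _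
  · exact tendsto_pi_nhds.2 fun ω => (hasSum_smul_basisVec (f ω)).tendsto_sum_nat

lemma hasSum_integral_inner {f : ℝ → H} (hf : Continuous f) (ψ : H) (t : ℝ) :
    HasSum (fun n => (∫ s in (0 : ℝ)..t, f s n) * ψ n) (∫ s in (0 : ℝ)..t, ⟪f s, ψ⟫) := by
  have key : ∀ χ : H, ∫ s in (0 : ℝ)..t, ⟪f s, χ⟫ = ⟪∫ s in (0 : ℝ)..t, f s, χ⟫ := fun χ => by
    have h := ((innerSL ℝ χ).intervalIntegral_comp_comm (hf.intervalIntegrable (μ := volume) 0 t))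
    simp only [innerSL_apply_apply] at h
    simp_rw [real_inner_comm χ]
    exact h
  have h2 : ∀ n, ∫ s in (0 : ℝ)..t, f s n = (∫ s in (0 : ℝ)..t, f s : H) n := fun n => by
    simp_rw [← inner_basisVec, key]
  simp_rw [h2, key]
  exact hasSum_inner_mul _ _

end SequenceSpace

/-! ### Monotonicity and Gronwall. -/

section Calculus

lemma hasDerivAt_integral {f : ℝ → ℝ} (hf : Continuous f) (t : ℝ) :
    HasDerivAt (fun t => ∫ s in (0 : ℝ)..t, f s) (f t) t :=
  intervalIntegral.integral_hasDerivAt_right (hf.intervalIntegrable _ _)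
    hf.stronglyMeasurable.stronglyMeasurableAtFilter hf.continuousAt

/-- Only positive times are constrained: the paths below are frozen for negative times, where the
differential identities fail. -/
lemma le_of_hasDerivAt_nonpos {f f' : ℝ → ℝ} (hf : ∀ t, HasDerivAt f (f' t) t) {t : ℝ}
    (ht : 0 ≤ t) (h : ∀ s, 0 < s → f' s ≤ 0) : f t ≤ f 0 := by
  have hd : Differentiable ℝ f := fun t => (hf t).differentiableAt
  refine antitoneOn_of_deriv_nonpos (convex_Ici 0) hd.continuous.continuousOn
    hd.differentiableOn (fun x hx => ?_) (Set.mem_Ici.2 le_rfl) (Set.mem_Ici.2 ht) ht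
  rw [interior_Ici, Set.mem_Ioi] at hx
  rw [(hf x).deriv]
  exact h x hx

/-- Gronwall's inequality in integral form. -/
lemma le_mul_exp_of_le_integral {f : ℝ → ℝ} (hf : Continuous f) {a c T : ℝ} (hc : 0 ≤ c)
    (h : ∀ t, 0 ≤ t → t ≤ T → f t ≤ a + c * ∫ s in (0 : ℝ)..t, f s) {t : ℝ} (ht : 0 ≤ t)
    (htT : t ≤ T) : f t ≤ a * Real.exp (c * t) := by
  have hd : ∀ s, HasDerivAt (fun t => (a + c * ∫ s in (0 : ℝ)..t, f s) * Real.exp (-(c * t)))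
      (c * f s * Real.exp (-(c * s)) +
        (a + c * ∫ r in (0 : ℝ)..s, f r) * (Real.exp (-(c * s)) * -(c * 1))) s := fun s =>
    (((hasDerivAt_integral hf s).const_mul c).const_add a).mul
      (((hasDerivAt_id s).const_mul c).neg.exp)
  -- The derivative is `c (f - a - c ∫ f) e^{-ct} ≤ 0`; neither `a` nor `f` needs a sign.
  have key : (a + c * ∫ s in (0 : ℝ)..t, f s) * Real.exp (-(c * t)) ≤ a := by
    have hda : AntitoneOn (fun t => (a + c * ∫ s in (0 : ℝ)..t, f s) * Real.exp (-(c * t)))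
        (Set.Icc 0 T) := by
      have hdiff : Differentiable ℝ
          (fun t => (a + c * ∫ s in (0 : ℝ)..t, f s) * Real.exp (-(c * t))) :=
        fun s => (hd s).differentiableAt
      refine antitoneOn_of_deriv_nonpos (convex_Icc 0 T) hdiff.continuous.continuousOn
        hdiff.differentiableOn fun s hs => ?_
      rw [interior_Icc] at hs
      rw [(hd s).deriv]
      have h1 := mul_le_mul_of_nonneg_left (h s hs.1.le hs.2.le)
        (mul_nonneg hc (Real.exp_pos (-(c * s))).le)
      nlinarith
    simpa using hda (Set.mem_Icc.2 ⟨le_rfl, ht.trans htT⟩) (Set.mem_Icc.2 ⟨ht, htT⟩) ht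
  have h2 := h t ht htT
  have h3 := mul_le_mul_of_nonneg_right key (Real.exp_pos (c * t)).le
  rw [mul_assoc, ← Real.exp_add, neg_add_cancel, Real.exp_zero, mul_one] at h3
  exact h2.trans h3

lemma integral_mono_right {f : ℝ → ℝ} (hf : Continuous f) (h0 : ∀ s, 0 ≤ f s) {s t : ℝ}
    (hst : s ≤ t) : ∫ r in (0 : ℝ)..s, f r ≤ ∫ r in (0 : ℝ)..t, f r := by
  rw [← intervalIntegral.integral_add_adjacent_intervals (hf.intervalIntegrable 0 s)
    (hf.intervalIntegrable s t)]
  exact le_add_of_nonneg_right (intervalIntegral.integral_nonneg hst fun u _ => h0 u)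

end Calculus

/-! ### The scalar equation `y' = f - lam y`. -/

section Duhamel

/-- The solution `y(t) = ∫₀ᵗ e^{-lam (t - s)} f(s) ds` of `y' = f - lam y`, `y(0) = 0`. -/
def duhamel (lam : ℝ) (f : ℝ → ℝ) (t : ℝ) : ℝ :=
  Real.exp (-(lam * t)) * ∫ s in (0 : ℝ)..t, Real.exp (lam * s) * f s

variable {lam : ℝ} {f g : ℝ → ℝ}

@[simp] lemma duhamel_at_zero : duhamel lam f 0 = 0 := by simp [duhamel]

lemma hasDerivAt_duhamel (hf : Continuous f) (t : ℝ) :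
    HasDerivAt (duhamel lam f) (f t - lam * duhamel lam f t) t := by
  have h := ((((hasDerivAt_id t).const_mul lam).neg.exp)).mul
    (hasDerivAt_integral (f := fun s => Real.exp (lam * s) * f s) (by fun_prop) t)
  refine h.congr_deriv ?_
  have e : Real.exp (-(lam * t)) * Real.exp (lam * t) = 1 := by
    rw [← Real.exp_add, neg_add_cancel, Real.exp_zero]
  simp only [duhamel, Pi.neg_apply, id]
  linear_combination f t * e

lemma continuous_duhamel (hf : Continuous f) : Continuous (duhamel lam f) :=
  continuous_iff_continuousAt.2 fun t => (hasDerivAt_duhamel hf t).continuousAt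

lemma duhamel_sub (hf : Continuous f) (hg : Continuous g) (t : ℝ) :
    duhamel lam (fun s => f s - g s) t = duhamel lam f t - duhamel lam g t := by
  simp only [duhamel, mul_sub]
  rw [intervalIntegral.integral_sub (Continuous.intervalIntegrable (by fun_prop) _ _)
    (Continuous.intervalIntegrable (by fun_prop) _ _), mul_sub]

/-- Completing the square: `(y²)' - f²/(2 lam) = -(f - 2 lam y)²/(2 lam) ≤ 0`. -/
lemma duhamel_sq_le (hf : Continuous f) (hlam : 0 < lam) {t : ℝ} (ht : 0 ≤ t) :
    duhamel lam f t ^ 2 ≤ 1 / (2 * lam) * ∫ s in (0 : ℝ)..t, f s ^ 2 := by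
  have hd : ∀ s, HasDerivAt
      (fun t => duhamel lam f t ^ 2 - 1 / (2 * lam) * ∫ s in (0 : ℝ)..t, f s ^ 2) _ s := fun s =>
    ((hasDerivAt_duhamel hf s).pow 2).sub
      ((hasDerivAt_integral (f := fun s => f s ^ 2) (by fun_prop) s).const_mul (1 / (2 * lam)))
  have := le_of_hasDerivAt_nonpos hd ht fun s _ => ?_
  · simpa using this
  · have h1 : 0 ≤ 1 / (2 * lam) * (f s - 2 * lam * duhamel lam f s) ^ 2 := by positivity
    have e2 : 1 / (2 * lam) * (f s - 2 * lam * duhamel lam f s) ^ 2 =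
      1 / (2 * lam) * f s ^ 2 - 2 * duhamel lam f s * f s + 2 * lam * duhamel lam f s ^ 2 := by
      field_simp
      ring
    simp only [Nat.cast_ofNat, Nat.add_one_sub_one, pow_one]
    nlinarith

/-- The kernel `lam e^{-lam(t-s)}` has mass at most `1`, which makes the bound uniform over the
shells. -/
lemma abs_duhamel_le (hlam : 0 < lam) {t c : ℝ} (ht : 0 ≤ t)
    (hc : ∀ s, 0 ≤ s → s ≤ t → |f s| ≤ c) : lam * |duhamel lam f t| ≤ c := by
  have h1 : ∫ s in (0 : ℝ)..t, Real.exp (lam * s) = (Real.exp (lam * t) - 1) / lam := by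
    rw [intervalIntegral.integral_comp_mul_left (fun x => Real.exp x) hlam.ne']
    simp [integral_exp, div_eq_inv_mul]
  have h2 : |∫ s in (0 : ℝ)..t, Real.exp (lam * s) * f s| ≤
      ∫ s in (0 : ℝ)..t, Real.exp (lam * s) * c := by
    have hcont : Continuous fun s => Real.exp (lam * s) * c := by fun_prop
    rw [← Real.norm_eq_abs]
    refine intervalIntegral.norm_integral_le_of_norm_le ht ?_
      (hcont.intervalIntegrable (μ := volume) _ _)
    refine Eventually.of_forall fun s hs => ?_
    rw [norm_mul, Real.norm_eq_abs, Real.abs_exp]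
    exact mul_le_mul_of_nonneg_left (hc s hs.1.le hs.2) (Real.exp_pos _).le
  have hc0 : 0 ≤ c := (abs_nonneg _).trans (hc 0 le_rfl ht)
  rw [intervalIntegral.integral_mul_const, h1] at h2
  rw [duhamel, abs_mul, Real.abs_exp]
  have h3 := mul_le_mul_of_nonneg_left h2 (mul_pos hlam (Real.exp_pos (-(lam * t)))).le
  have e : Real.exp (-(lam * t)) * Real.exp (lam * t) = 1 := by
    rw [← Real.exp_add, neg_add_cancel, Real.exp_zero]
  have e2 : lam * Real.exp (-(lam * t)) * ((Real.exp (lam * t) - 1) / lam * c) =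
      c - Real.exp (-(lam * t)) * c := by
    field_simp
    linear_combination c * e
  have h4 := mul_nonneg (Real.exp_pos (-(lam * t))).le hc0
  nlinarith

end Duhamel

/-! ### The smoothing convolution with `A^{1/2} e^{-νtA}`. -/

section Convolution

variable {k₀ ν : ℝ}

lemma wave_pos (hk₀ : 0 < k₀) (n : ℕ) : 0 < wave k₀ n := by
  unfold wave
  positivity

/-- The map `f ↦ ∫₀ᵗ A^{1/2} e^{-ν (t - s) A} f(s) ds`, with `t` replaced by `0` if `t < 0`. -/
def smoothing (k₀ ν : ℝ) (f : ℝ → H) (t : ℝ) : H :=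
  toH fun n => duhamel (ν * wave k₀ (n + 1) ^ 2) (fun s => wave k₀ (n + 1) * f s n) (max t 0)

variable {f g : ℝ → H}

/-- The factor `k_n²` from the source cancels against the decay rate `ν k_n²`, leaving a constant
independent of the shell. -/
lemma smoothing_coord_sq_le (hk₀ : 0 < k₀) (hν : 0 < ν) (hf : Continuous f) (n : ℕ) {t : ℝ}
    (ht : 0 ≤ t) :
    duhamel (ν * wave k₀ (n + 1) ^ 2) (fun s => wave k₀ (n + 1) * f s n) t ^ 2 ≤
      1 / (2 * ν) * ∫ s in (0 : ℝ)..t, f s n ^ 2 := by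
  have hw := wave_pos hk₀ (n + 1)
  have hfn : Continuous fun s => f s n := (continuous_apply n).comp hf
  refine (duhamel_sq_le (by fun_prop) (by positivity) ht).trans_eq ?_
  simp_rw [mul_pow]
  rw [intervalIntegral.integral_const_mul]
  field_simp

lemma sum_integral_sq_le (hf : Continuous f) (N : ℕ) {t : ℝ} (ht : 0 ≤ t) :
    ∑ n ∈ Finset.range N, ∫ s in (0 : ℝ)..t, f s n ^ 2 ≤ ∫ s in (0 : ℝ)..t, ‖f s‖ ^ 2 := by
  have hfn : ∀ n, Continuous fun s => f s n := fun n => (continuous_apply n).comp hf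
  have hfn2 : ∀ n, Continuous fun s => f s n ^ 2 := fun n => (hfn n).pow 2
  rw [← intervalIntegral.integral_finsetSum fun n _ => ((hfn2 n).intervalIntegrable _ _)]
  refine intervalIntegral.integral_mono_on ht
    (Continuous.intervalIntegrable (by fun_prop) _ _)
    (Continuous.intervalIntegrable (by fun_prop) _ _) fun s _ => sum_range_sq_le (f s) N

lemma summable_integral_sq (hf : Continuous f) {t : ℝ} (ht : 0 ≤ t) :
    Summable fun n => ∫ s in (0 : ℝ)..t, f s n ^ 2 :=
  summable_of_sum_range_le
    (fun _ => intervalIntegral.integral_nonneg ht fun _ _ => sq_nonneg _)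
    fun N => sum_integral_sq_le hf N ht

lemma smoothing_apply (hk₀ : 0 < k₀) (hν : 0 < ν) (hf : Continuous f) (t : ℝ) (n : ℕ) :
    smoothing k₀ ν f t n =
      duhamel (ν * wave k₀ (n + 1) ^ 2) (fun s => wave k₀ (n + 1) * f s n) (max t 0) := by
  refine toH_apply (Summable.of_nonneg_of_le (fun _ => sq_nonneg _)
    (fun n => smoothing_coord_sq_le hk₀ hν hf n (le_max_right t 0))
    ((summable_integral_sq hf (le_max_right t 0)).mul_left _)) n

lemma norm_smoothing_sq_le (hk₀ : 0 < k₀) (hν : 0 < ν) (hf : Continuous f) (t : ℝ) :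
    ‖smoothing k₀ ν f t‖ ^ 2 ≤ 1 / (2 * ν) * ∫ s in (0 : ℝ)..(max t 0), ‖f s‖ ^ 2 := by
  refine norm_sq_le_of_sum_range_le fun N => ?_
  simp_rw [smoothing_apply hk₀ hν hf]
  refine (Finset.sum_le_sum fun n _ =>
    smoothing_coord_sq_le hk₀ hν hf n (le_max_right t 0)).trans ?_
  rw [← Finset.mul_sum]
  exact mul_le_mul_of_nonneg_left (sum_integral_sq_le hf N (le_max_right t 0)) (by positivity)

lemma smoothing_sub (hk₀ : 0 < k₀) (hν : 0 < ν) (hf : Continuous f) (hg : Continuous g) (t : ℝ) :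
    smoothing k₀ ν f t - smoothing k₀ ν g t = smoothing k₀ ν (fun s => f s - g s) t := by
  have hfn : ∀ n, Continuous fun s => f s n := fun n => (continuous_apply n).comp hf
  have hgn : ∀ n, Continuous fun s => g s n := fun n => (continuous_apply n).comp hg
  ext n
  have hfg : Continuous fun s => f s - g s := hf.sub hg
  rw [H.sub_apply, smoothing_apply hk₀ hν hf, smoothing_apply hk₀ hν hg,
    smoothing_apply hk₀ hν hfg, ← duhamel_sub (by fun_prop) (by fun_prop)]
  simp only [H.sub_apply, mul_sub]

lemma smoothing_congr {t : ℝ} (ht : 0 ≤ t) (h : ∀ s, 0 ≤ s → s ≤ t → f s = g s) :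
    smoothing k₀ ν f t = smoothing k₀ ν g t := by
  unfold smoothing duhamel
  rw [max_eq_left ht]
  congr 1
  ext n
  congr 1
  refine intervalIntegral.integral_congr fun s hs => ?_
  rw [Set.uIcc_of_le ht, Set.mem_Icc] at hs
  simp only [h s hs.1 hs.2]

lemma continuous_smoothing (hk₀ : 0 < k₀) (hν : 0 < ν) (hf : Continuous f) :
    Continuous (smoothing k₀ ν f) := by
  have hfn : ∀ n, Continuous fun s => f s n := fun n => (continuous_apply n).comp hf
  refine continuous_iff_continuousAt.2 fun t => ?_
  have h0 : 0 ≤ max (t + 1) 0 := le_max_right _ _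
  refine continuousAt_of_apply (fun n => ?_) ((summable_integral_sq hf h0).mul_left (1 / (2 * ν))) ?_
  · simp_rw [smoothing_apply hk₀ hν hf]
    exact ((continuous_duhamel (by fun_prop)).comp
      (continuous_id.max continuous_const)).continuousAt
  · filter_upwards [Iio_mem_nhds (lt_add_one t)] with y hy n
    rw [smoothing_apply hk₀ hν hf]
    refine (smoothing_coord_sq_le hk₀ hν hf n (le_max_right y 0)).trans ?_
    have hn := hfn n
    exact mul_le_mul_of_nonneg_left (integral_mono_right (by fun_prop) (fun s => sq_nonneg _)
      (max_le_max_right 0 (le_of_lt hy))) (by positivity)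

end Convolution

/-! ### The nonlinearity and its truncation. -/

section Nonlinearity

/-- The sequence `(k_n⁻¹ (B(u,v))_n)`. -/
def bilSeq (u v : ℕ → ℝ) : ℕ → ℝ
  | 0 => -(u 0 * v 1)
  | i + 1 => u i * v i / 2 - u (i + 1) * v (i + 2)

/-- The coefficient `1/2` in `bilSeq` is the ratio `k_{n-1} / k_n`. -/
lemma Bseq_eq_wave_mul (k₀ : ℝ) (u v : ℕ → ℝ) (n : ℕ) :
    Bseq k₀ u v n = wave k₀ (n + 1) * bilSeq u v n := by
  cases n with
  | zero => simp only [Bseq, bilSeq]; ring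
  | succ i => simp only [Bseq, bilSeq, wave]; ring

lemma sum_bilSeq_sq_le (u v : H) (N : ℕ) :
    ∑ n ∈ Finset.range N, bilSeq u v n ^ 2 ≤ 4 * (‖u‖ ^ 2 * ‖v‖ ^ 2) := by
  have h0 : bilSeq u v 0 ^ 2 ≤ ‖u‖ ^ 2 * ‖v‖ ^ 2 := by
    simp only [bilSeq, neg_sq, mul_pow]
    exact mul_le_mul (sq_apply_le_norm_sq u 0) (sq_apply_le_norm_sq v 1) (sq_nonneg _)
      (sq_nonneg _)
  have h1 : ∀ i, bilSeq u v (i + 1) ^ 2 ≤ ‖u‖ ^ 2 * (v i ^ 2 / 2 + 2 * v (i + 2) ^ 2) := by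
    intro i
    have a1 := mul_le_mul_of_nonneg_right (sq_apply_le_norm_sq u i) (sq_nonneg (v i))
    have a2 := mul_le_mul_of_nonneg_right (sq_apply_le_norm_sq u (i + 1)) (sq_nonneg (v (i + 2)))
    simp only [bilSeq]
    nlinarith [sq_nonneg (u i * v i / 2 + u (i + 1) * v (i + 2))]
  have h2 : bilSeq u v 0 ^ 2 + ∑ n ∈ Finset.range N, bilSeq u v (n + 1) ^ 2 ≤
      ‖u‖ ^ 2 * ‖v‖ ^ 2 + ‖u‖ ^ 2 * (‖v‖ ^ 2 / 2 + 2 * ‖v‖ ^ 2) := by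
    refine add_le_add h0 ((Finset.sum_le_sum fun i _ => h1 i).trans ?_)
    rw [← Finset.mul_sum, Finset.sum_add_distrib, ← Finset.sum_div, ← Finset.mul_sum]
    have a1 := sum_range_sq_le v N
    have a2 := sum_range_shift_sq_le v 2 N
    refine mul_le_mul_of_nonneg_left ?_ (sq_nonneg _)
    linarith
  calc ∑ n ∈ Finset.range N, bilSeq u v n ^ 2
      ≤ ∑ n ∈ Finset.range (N + 1), bilSeq u v n ^ 2 := by
        rw [Finset.sum_range_succ]
        exact le_add_of_nonneg_right (sq_nonneg _)
    _ ≤ 4 * (‖u‖ ^ 2 * ‖v‖ ^ 2) := by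
        rw [Finset.sum_range_succ', add_comm]
        nlinarith [mul_nonneg (sq_nonneg ‖u‖) (sq_nonneg ‖v‖)]

/-- The bounded bilinear map `A^{-1/2} B : H × H → H`. -/
def bil (u v : H) : H := toH (bilSeq u v)

lemma bil_apply (u v : H) (n : ℕ) : bil u v n = bilSeq u v n :=
  toH_apply (summable_of_sum_range_le (fun _ => sq_nonneg _) (sum_bilSeq_sq_le u v)) n

lemma norm_bil_le (u v : H) : ‖bil u v‖ ≤ 2 * ‖u‖ * ‖v‖ := by
  have h : ‖bil u v‖ ^ 2 ≤ 4 * (‖u‖ ^ 2 * ‖v‖ ^ 2) := norm_sq_le_of_sum_range_le fun N => by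
    simp_rw [bil_apply]
    exact sum_bilSeq_sq_le u v N
  refine le_of_sq_le_sq (h.trans_eq (by ring)) (by positivity)

lemma bil_sub_left (u v w : H) : bil (u - v) w = bil u w - bil v w := by
  ext n
  simp only [H.sub_apply, bil_apply]
  cases n <;> simp only [bilSeq, H.sub_apply] <;> ring

lemma bil_sub_right (u v w : H) : bil u (v - w) = bil u v - bil u w := by
  ext n
  simp only [H.sub_apply, bil_apply]
  cases n <;> simp only [bilSeq, H.sub_apply] <;> ring

lemma bil_smul_smul (c : ℝ) (u v : H) : bil (c • u) (c • v) = c ^ 2 • bil u v := by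
  ext n
  simp only [H.smul_apply, bil_apply]
  cases n <;> simp only [bilSeq, H.smul_apply] <;> ring

/-- The retraction of `H` onto the ball of radius `R`. -/
def trunc (R : ℝ) (u : H) : H := (R / max R ‖u‖) • u

variable {R : ℝ}

lemma trunc_of_norm_le (hR : 0 < R) {u : H} (hu : ‖u‖ ≤ R) : trunc R u = u := by
  rw [trunc, max_eq_left hu, div_self hR.ne', one_smul]

lemma norm_trunc_le (hR : 0 < R) (u : H) : ‖trunc R u‖ ≤ R := by
  have hm : 0 < max R ‖u‖ := lt_max_of_lt_left hR
  rw [trunc, norm_smul, Real.norm_of_nonneg (by positivity), div_mul_eq_mul_div,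
    div_le_iff₀ hm]
  exact mul_le_mul_of_nonneg_left (le_max_right _ _) hR.le

lemma norm_trunc_sub_le (hR : 0 < R) (u v : H) : ‖trunc R u - trunc R v‖ ≤ 2 * ‖u - v‖ := by
  have hu : 0 < max R ‖u‖ := lt_max_of_lt_left hR
  have hv : 0 < max R ‖v‖ := lt_max_of_lt_left hR
  have e : trunc R u - trunc R v =
      -- The change of vector and the change of scaling factor each contribute at most `‖u - v‖`,
      -- hence the constant `2`.
      (R / max R ‖u‖) • (u - v) + (R / max R ‖u‖ - R / max R ‖v‖) • v := by
    simp only [trunc, smul_sub, sub_smul]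
    abel
  have h1 : R / max R ‖u‖ ≤ 1 := (div_le_one hu).2 (le_max_left _ _)
  have h2 : ‖v‖ / max R ‖v‖ ≤ 1 := (div_le_one hv).2 (le_max_right _ _)
  have h3 : |max R ‖v‖ - max R ‖u‖| ≤ ‖u - v‖ := by
    rw [abs_sub_comm, max_comm R, max_comm R]
    exact (abs_max_sub_max_le_abs _ _ _).trans (abs_norm_sub_norm_le u v)
  have e2 : R / max R ‖u‖ - R / max R ‖v‖ =
      (R / max R ‖u‖) * ((max R ‖v‖ - max R ‖u‖) / max R ‖v‖) := by
    field_simp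
  rw [e]
  refine (norm_add_le _ _).trans ?_
  have h0 : ‖R / max R ‖u‖‖ = R / max R ‖u‖ := Real.norm_of_nonneg (by positivity)
  rw [norm_smul, norm_smul, e2, norm_mul, h0, norm_div, Real.norm_of_nonneg hv.le,
    Real.norm_eq_abs]
  have h4 : R / max R ‖u‖ * (|max R ‖v‖ - max R ‖u‖| / max R ‖v‖) * ‖v‖ =
    R / max R ‖u‖ * (|max R ‖v‖ - max R ‖u‖| * (‖v‖ / max R ‖v‖)) := by ring
  rw [h4]
  have h5 : |max R ‖v‖ - max R ‖u‖| * (‖v‖ / max R ‖v‖) ≤ ‖u - v‖ * 1 :=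
    mul_le_mul h3 h2 (by positivity) (norm_nonneg _)
  have h6 : R / max R ‖u‖ * (|max R ‖v‖ - max R ‖u‖| * (‖v‖ / max R ‖v‖)) ≤ 1 * (‖u - v‖ * 1) :=
    mul_le_mul h1 h5 (by positivity) zero_le_one
  have h7 := mul_le_mul_of_nonneg_right h1 (norm_nonneg (u - v))
  linarith

/-- The truncated nonlinearity `A^{-1/2} B(π_R u, π_R u)`. -/
def truncBil (R : ℝ) (u : H) : H := bil (trunc R u) (trunc R u)

lemma truncBil_of_norm_le (hR : 0 < R) {u : H} (hu : ‖u‖ ≤ R) : truncBil R u = bil u u := by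
  rw [truncBil, trunc_of_norm_le hR hu]

/-- Truncation only rescales `bil u u` by a number in `[0, 1]` when `R > 0`, so the cancellation in
the energy balance survives it. -/
lemma truncBil_eq_smul (R : ℝ) (u : H) : truncBil R u = (R / max R ‖u‖) ^ 2 • bil u u :=
  bil_smul_smul _ _ _

lemma norm_bil_self_sub_le (u v : H) :
    ‖bil u u - bil v v‖ ≤ 2 * (‖u‖ + ‖v‖) * ‖u - v‖ := by
  have e : bil u u - bil v v = bil u (u - v) + bil (u - v) v := by
    rw [bil_sub_left, bil_sub_right]
    abel
  rw [e]
  refine (norm_add_le _ _).trans ((add_le_add (norm_bil_le _ _) (norm_bil_le _ _)).trans_eq ?_)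
  ring

lemma norm_truncBil_sub_le (hR : 0 < R) (u v : H) :
    ‖truncBil R u - truncBil R v‖ ≤ 8 * R * ‖u - v‖ := by
  refine (norm_bil_self_sub_le _ _).trans ?_
  have h1 := norm_trunc_le hR u
  have h2 := norm_trunc_le hR v
  have h3 := norm_trunc_sub_le hR u v
  calc 2 * (‖trunc R u‖ + ‖trunc R v‖) * ‖trunc R u - trunc R v‖
      ≤ 2 * (R + R) * (2 * ‖u - v‖) := by gcongr
    _ = 8 * R * ‖u - v‖ := by ring

lemma continuous_bil_self : Continuous fun u : H => bil u u := by
  refine continuous_iff_continuousAt.2 fun u => ?_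
  rw [ContinuousAt, tendsto_iff_norm_sub_tendsto_zero]
  refine squeeze_zero (fun _ => norm_nonneg _) (fun v => norm_bil_self_sub_le v u) ?_
  have h : Continuous fun v : H => 2 * (‖v‖ + ‖u‖) * ‖v - u‖ := by fun_prop
  simpa using h.tendsto u

end Nonlinearity

/-! ### Picard iteration for a Lipschitz drift. -/

section Picard

variable {k₀ ν L : ℝ} {β : H → H} {g : ℝ → H}

/-- The Picard iteration for `u = g + ∫₀ᵗ A^{1/2} e^{-ν (t - s) A} β(u(s)) ds`. -/
def picard (k₀ ν : ℝ) (β : H → H) (g : ℝ → H) : ℕ → ℝ → H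
  | 0 => g
  | j + 1 => fun t => g t + smoothing k₀ ν (fun s => β (picard k₀ ν β g j s)) t

lemma continuous_of_lipschitz (hβ : ∀ u v, ‖β u - β v‖ ≤ L * ‖u - v‖) : Continuous β := by
  refine (LipschitzWith.of_dist_le_mul (K := L.toNNReal) fun u v => ?_).continuous
  rw [dist_eq_norm, dist_eq_norm]
  exact (hβ u v).trans (mul_le_mul_of_nonneg_right (Real.le_coe_toNNReal L) (norm_nonneg _))

lemma continuous_picard (hk₀ : 0 < k₀) (hν : 0 < ν) (hβ : Continuous β) (hg : Continuous g)
    (j : ℕ) : Continuous (picard k₀ ν β g j) := by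
  induction j with
  | zero => exact hg
  | succ j ih => exact hg.add (continuous_smoothing hk₀ hν (hβ.comp ih))

lemma norm_smoothing_comp_sub_sq_le (hk₀ : 0 < k₀) (hν : 0 < ν)
    (hβ : ∀ u v, ‖β u - β v‖ ≤ L * ‖u - v‖) {x y : ℝ → H} (hx : Continuous x) (hy : Continuous y)
    (t : ℝ) :
    ‖smoothing k₀ ν (fun s => β (x s)) t - smoothing k₀ ν (fun s => β (y s)) t‖ ^ 2 ≤
      (L ^ 2 / (2 * ν) + 1) * ∫ s in (0 : ℝ)..(max t 0), ‖x s - y s‖ ^ 2 := by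
  have hβc := continuous_of_lipschitz hβ
  have hβx : Continuous fun s => β (x s) := hβc.comp hx
  have hβy : Continuous fun s => β (y s) := hβc.comp hy
  rw [smoothing_sub hk₀ hν hβx hβy]
  refine (norm_smoothing_sq_le hk₀ hν (hβx.sub hβy) t).trans ?_
  have h1 : ∫ s in (0 : ℝ)..(max t 0), ‖β (x s) - β (y s)‖ ^ 2 ≤
      ∫ s in (0 : ℝ)..(max t 0), L ^ 2 * ‖x s - y s‖ ^ 2 := by
    refine intervalIntegral.integral_mono_on (le_max_right _ _)
      (Continuous.intervalIntegrable (by fun_prop) _ _)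
      (Continuous.intervalIntegrable (by fun_prop) _ _) fun s _ => ?_
    rw [← mul_pow]
    exact pow_le_pow_left₀ (norm_nonneg _) (hβ _ _) 2
  have h2 : 0 ≤ ∫ s in (0 : ℝ)..(max t 0), ‖x s - y s‖ ^ 2 :=
    intervalIntegral.integral_nonneg (le_max_right _ _) fun _ _ => sq_nonneg _
  rw [intervalIntegral.integral_const_mul] at h1
  calc _ ≤ 1 / (2 * ν) * (L ^ 2 * ∫ s in (0 : ℝ)..(max t 0), ‖x s - y s‖ ^ 2) :=
        mul_le_mul_of_nonneg_left h1 (by positivity)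
    _ = L ^ 2 / (2 * ν) * ∫ s in (0 : ℝ)..(max t 0), ‖x s - y s‖ ^ 2 := by ring
    _ ≤ _ := mul_le_mul_of_nonneg_right (by linarith) h2

/-- The weight `e^{2Kt}` turns each iteration into a contraction on any time interval: `K ∫₀ᵗ
e^{2Ks} ds ≤ e^{2Kt}/2`. The summand `1` in `K` keeps `K` positive when `L = 0`. -/
lemma norm_picard_succ_sub_sq_le (hk₀ : 0 < k₀) (hν : 0 < ν)
    (hβ : ∀ u v, ‖β u - β v‖ ≤ L * ‖u - v‖) (hg : Continuous g) {T : ℝ} (j : ℕ) {t : ℝ}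
    (ht : t ≤ max T 0) :
    ‖picard k₀ ν β g (j + 1) t - picard k₀ ν β g j t‖ ^ 2 ≤
      1 / (2 * ν) * (∫ s in (0 : ℝ)..(max T 0), ‖β (g s)‖ ^ 2) *
        Real.exp (2 * (L ^ 2 / (2 * ν) + 1) * max t 0) * (1 / 2) ^ j := by
  have hβc := continuous_of_lipschitz hβ
  set K := L ^ 2 / (2 * ν) + 1 with hK
  have hKpos : 0 < K := by positivity
  set M := 1 / (2 * ν) * (∫ s in (0 : ℝ)..(max T 0), ‖β (g s)‖ ^ 2) with hM
  have hM0 : 0 ≤ M := mul_nonneg (by positivity)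
    (intervalIntegral.integral_nonneg (le_max_right _ _) fun _ _ => sq_nonneg _)
  induction j generalizing t with
  | zero =>
    have hβg : Continuous fun s => β (g s) := hβc.comp hg
    simp only [picard, add_sub_cancel_left, pow_zero, mul_one]
    refine (norm_smoothing_sq_le hk₀ hν hβg t).trans ?_
    have h1 : 1 / (2 * ν) * ∫ s in (0 : ℝ)..(max t 0), ‖β (g s)‖ ^ 2 ≤ M :=
      mul_le_mul_of_nonneg_left (integral_mono_right (by fun_prop) (fun _ => sq_nonneg _)
        (max_le ht (le_max_right _ _))) (by positivity)
    refine h1.trans (le_mul_of_one_le_right hM0 (Real.one_le_exp ?_))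
    have := le_max_right t 0
    positivity
  | succ j ih =>
    have hc := continuous_picard hk₀ hν hβc hg
    have e : picard k₀ ν β g (j + 1 + 1) t - picard k₀ ν β g (j + 1) t =
        smoothing k₀ ν (fun s => β (picard k₀ ν β g (j + 1) s)) t -
          smoothing k₀ ν (fun s => β (picard k₀ ν β g j s)) t := add_sub_add_left_eq_sub _ _ _
    rw [e]
    refine (norm_smoothing_comp_sub_sq_le hk₀ hν hβ (hc _) (hc _) t).trans ?_
    have hcj := hc j
    have hcj' := hc (j + 1)
    have h1 : ∫ s in (0 : ℝ)..(max t 0), ‖picard k₀ ν β g (j + 1) s - picard k₀ ν β g j s‖ ^ 2 ≤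
        ∫ s in (0 : ℝ)..(max t 0), M * Real.exp (2 * K * s) * (1 / 2) ^ j := by
      refine intervalIntegral.integral_mono_on (le_max_right _ _)
        (Continuous.intervalIntegrable (by fun_prop) _ _)
        (Continuous.intervalIntegrable (by fun_prop) _ _) fun s hs => ?_
      have := ih (hs.2.trans (max_le ht (le_max_right _ _)))
      rwa [max_eq_left hs.1] at this
    have h2 : ∫ s in (0 : ℝ)..(max t 0), M * Real.exp (2 * K * s) * (1 / 2) ^ j =
        M * ((Real.exp (2 * K * max t 0) - 1) / (2 * K)) * (1 / 2) ^ j := by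
      rw [intervalIntegral.integral_mul_const, intervalIntegral.integral_const_mul,
        intervalIntegral.integral_comp_mul_left (fun x => Real.exp x) (by positivity)]
      simp [integral_exp, div_eq_inv_mul]
    rw [h2] at h1
    refine (mul_le_mul_of_nonneg_left h1 hKpos.le).trans ?_
    have e3 : K * (M * ((Real.exp (2 * K * max t 0) - 1) / (2 * K)) * (1 / 2) ^ j) =
        M * (Real.exp (2 * K * max t 0) - 1) * (1 / 2) ^ (j + 1) := by
      field_simp
      ring
    rw [e3]
    exact mul_le_mul_of_nonneg_right (mul_le_mul_of_nonneg_left (by linarith) hM0) (by positivity)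

/-- The Picard iterates converge geometrically, uniformly on bounded time intervals. -/
lemma exists_norm_picard_succ_sub_le (hk₀ : 0 < k₀) (hν : 0 < ν)
    (hβ : ∀ u v, ‖β u - β v‖ ≤ L * ‖u - v‖) (hg : Continuous g) (T : ℝ) :
    ∃ C : ℝ, 0 ≤ C ∧ ∀ j t, t ≤ T →
      dist (picard k₀ ν β g j t) (picard k₀ ν β g (j + 1) t) ≤ C * (√(1 / 2)) ^ j := by
  set K := L ^ 2 / (2 * ν) + 1 with hK
  have hKpos : 0 < K := by positivity
  set M := 1 / (2 * ν) * (∫ s in (0 : ℝ)..(max T 0), ‖β (g s)‖ ^ 2) with hM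
  have hM0 : 0 ≤ M := mul_nonneg (by positivity)
    (intervalIntegral.integral_nonneg (le_max_right _ _) fun _ _ => sq_nonneg _)
  refine ⟨√(M * Real.exp (2 * K * max T 0)), Real.sqrt_nonneg _, fun j t ht => ?_⟩
  rw [dist_comm, dist_eq_norm]
  refine le_of_sq_le_sq ?_ (by positivity)
  refine (norm_picard_succ_sub_sq_le hk₀ hν hβ hg j (ht.trans (le_max_left _ _))).trans ?_
  rw [mul_pow, Real.sq_sqrt (by positivity), ← pow_mul, mul_comm j 2, pow_mul,
    Real.sq_sqrt (by norm_num)]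
  refine mul_le_mul_of_nonneg_right (mul_le_mul_of_nonneg_left (Real.exp_le_exp.2 ?_) hM0)
    (by positivity)
  exact mul_le_mul_of_nonneg_left (max_le_max_right 0 ht) (by positivity)

/-- The limit of the Picard iteration. -/
def picardLim (k₀ ν : ℝ) (β : H → H) (g : ℝ → H) (t : ℝ) : H :=
  limUnder atTop fun j => picard k₀ ν β g j t

lemma sqrt_half_lt_one : √(1 / 2) < (1 : ℝ) := by
  rw [Real.sqrt_lt' one_pos]
  norm_num

lemma tendsto_picard (hk₀ : 0 < k₀) (hν : 0 < ν)
    (hβ : ∀ u v, ‖β u - β v‖ ≤ L * ‖u - v‖) (hg : Continuous g) (t : ℝ) :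
    Tendsto (fun j => picard k₀ ν β g j t) atTop (𝓝 (picardLim k₀ ν β g t)) := by
  obtain ⟨C, -, hC⟩ := exists_norm_picard_succ_sub_le hk₀ hν hβ hg t
  exact (cauchySeq_of_le_geometric _ C sqrt_half_lt_one fun j => hC j t le_rfl).tendsto_limUnder

lemma exists_dist_picard_picardLim_le (hk₀ : 0 < k₀) (hν : 0 < ν)
    (hβ : ∀ u v, ‖β u - β v‖ ≤ L * ‖u - v‖) (hg : Continuous g) (T : ℝ) :
    ∃ C : ℝ, 0 ≤ C ∧ ∀ j t, t ≤ T →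
      dist (picard k₀ ν β g j t) (picardLim k₀ ν β g t) ≤ C * (√(1 / 2)) ^ j := by
  obtain ⟨C, hC0, hC⟩ := exists_norm_picard_succ_sub_le hk₀ hν hβ hg T
  have h1 : 0 < 1 - √(1 / 2 : ℝ) := sub_pos.2 sqrt_half_lt_one
  refine ⟨C / (1 - √(1 / 2)), by positivity, fun j t ht => ?_⟩
  refine (dist_le_of_le_geometric_of_tendsto _ _ sqrt_half_lt_one (fun j => hC j t ht)
    (tendsto_picard hk₀ hν hβ hg t) j).trans_eq ?_
  ring

lemma tendsto_mul_sqrt_half_pow (C : ℝ) :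
    Tendsto (fun j : ℕ => C * (√(1 / 2)) ^ j) atTop (𝓝 0) := by
  simpa using (tendsto_pow_atTop_nhds_zero_of_lt_one (Real.sqrt_nonneg _)
    sqrt_half_lt_one).const_mul C

lemma continuous_picardLim (hk₀ : 0 < k₀) (hν : 0 < ν)
    (hβ : ∀ u v, ‖β u - β v‖ ≤ L * ‖u - v‖) (hg : Continuous g) :
    Continuous (picardLim k₀ ν β g) := by
  refine continuous_iff_continuousAt.2 fun t => ?_
  obtain ⟨C, hC0, hC⟩ := exists_dist_picard_picardLim_le hk₀ hν hβ hg (t + 1)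
  have h : TendstoUniformlyOn (picard k₀ ν β g) (picardLim k₀ ν β g) atTop (Set.Iic (t + 1)) := by
    rw [Metric.tendstoUniformlyOn_iff]
    intro ε hε
    filter_upwards [(tendsto_mul_sqrt_half_pow C).eventually_lt_const hε] with j hj s hs
    rw [dist_comm]
    exact (hC j s hs).trans_lt hj
  exact (h.continuousOn (Frequently.of_forall fun j =>
    (continuous_picard hk₀ hν (continuous_of_lipschitz hβ) hg j).continuousOn)).continuousAt
    (Iic_mem_nhds (lt_add_one t))

lemma picardLim_eq (hk₀ : 0 < k₀) (hν : 0 < ν)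
    (hβ : ∀ u v, ‖β u - β v‖ ≤ L * ‖u - v‖) (hg : Continuous g) (t : ℝ) :
    picardLim k₀ ν β g t = g t + smoothing k₀ ν (fun s => β (picardLim k₀ ν β g s)) t := by
  have hβc := continuous_of_lipschitz hβ
  have hU := continuous_picardLim hk₀ hν hβ hg
  obtain ⟨C, hC0, hC⟩ := exists_dist_picard_picardLim_le hk₀ hν hβ hg (max t 0)
  set K := L ^ 2 / (2 * ν) + 1 with hK
  have hKpos : 0 < K := by positivity
  refine tendsto_nhds_unique ((tendsto_add_atTop_iff_nat 1).2 (tendsto_picard hk₀ hν hβ hg t)) ?_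
  refine Tendsto.const_add (g t) ?_
  rw [tendsto_iff_norm_sub_tendsto_zero]
  have h1 : ∀ j, ‖smoothing k₀ ν (fun s => β (picard k₀ ν β g j s)) t -
      smoothing k₀ ν (fun s => β (picardLim k₀ ν β g s)) t‖ ^ 2 ≤
      K * max t 0 * (C * (√(1 / 2)) ^ j) ^ 2 := fun j => by
    have hcj := continuous_picard hk₀ hν hβc hg j
    refine (norm_smoothing_comp_sub_sq_le hk₀ hν hβ hcj hU t).trans ?_
    rw [mul_assoc]
    refine mul_le_mul_of_nonneg_left ?_ hKpos.le
    have h2 : ∫ s in (0 : ℝ)..(max t 0), ‖picard k₀ ν β g j s - picardLim k₀ ν β g s‖ ^ 2 ≤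
        ∫ _ in (0 : ℝ)..(max t 0), (C * (√(1 / 2)) ^ j) ^ 2 := by
      refine intervalIntegral.integral_mono_on (le_max_right _ _)
        (Continuous.intervalIntegrable (by fun_prop) _ _)
        (Continuous.intervalIntegrable (by fun_prop) _ _) fun s hs => ?_
      rw [← dist_eq_norm]
      exact pow_le_pow_left₀ dist_nonneg (hC j s hs.2) 2
    simpa using h2
  have h3 : Tendsto (fun j : ℕ => K * max t 0 * (C * (√(1 / 2)) ^ j) ^ 2) atTop (𝓝 0) := by
    simpa using ((tendsto_mul_sqrt_half_pow C).pow 2).const_mul (K * max t 0)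
  have h4 := squeeze_zero (fun _ => sq_nonneg _) h1 h3
  simpa using (Real.continuous_sqrt.tendsto 0).comp h4 |>.congr fun j => by
    simp [Real.sqrt_sq]

/-- Gronwall with initial value `0`. The equations are needed only up to `T`, since a solution for
one radius solves the equation for another only while both truncations are inactive. -/
lemma eqOn_of_eq_add_smoothing (hk₀ : 0 < k₀) (hν : 0 < ν)
    (hβ : ∀ u v, ‖β u - β v‖ ≤ L * ‖u - v‖) {x y : ℝ → H} (hx : Continuous x)
    (hy : Continuous y) {T : ℝ}
    (hxT : ∀ t, 0 ≤ t → t ≤ T → x t = g t + smoothing k₀ ν (fun s => β (x s)) t)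
    (hyT : ∀ t, 0 ≤ t → t ≤ T → y t = g t + smoothing k₀ ν (fun s => β (y s)) t) {t : ℝ}
    (ht : 0 ≤ t) (htT : t ≤ T) : x t = y t := by
  have hc : Continuous fun s => ‖x s - y s‖ ^ 2 := by fun_prop
  have h := le_mul_exp_of_le_integral hc (a := 0) (c := L ^ 2 / (2 * ν) + 1) (T := T)
    (by positivity) (fun t ht htT => ?_) ht htT
  · rw [zero_mul] at h
    have h0 : ‖x t - y t‖ = 0 := by
      have := le_antisymm h (sq_nonneg _)
      simpa using this
    exact sub_eq_zero.1 (norm_eq_zero.1 h0)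
  · have h1 := norm_smoothing_comp_sub_sq_le hk₀ hν hβ hx hy t
    rw [max_eq_left ht] at h1
    rw [hxT t ht htT, hyT t ht htT, add_sub_add_left_eq_sub, zero_add]
    exact h1

end Picard

/-! ### The linear equation and the mild formulation. -/

section LinearPart

variable {k₀ ν : ℝ} {u₀ : H} {w : ℝ → H}

/-- The shells of `w` are, on every bounded time interval, dominated by a square summable
sequence: `∑ sup_{s ≤ T} w_n(s)² < ∞`. -/
def IsShellDominated (w : ℝ → H) : Prop :=
  ∀ T : ℝ, ∃ a : ℕ → ℝ, Summable a ∧ ∀ s, 0 ≤ s → s ≤ T → ∀ n, w s n ^ 2 ≤ a n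

/-- The solution `z` of `dz + ν A z dt = dw`, `z(0) = w(0)`, with time cut off at `0`. -/
def ouPath (k₀ ν : ℝ) (w : ℝ → H) (t : ℝ) : H :=
  toH fun n => w (max t 0) n -
    ν * wave k₀ (n + 1) ^ 2 * duhamel (ν * wave k₀ (n + 1) ^ 2) (fun s => w s n) (max t 0)

lemma ouPath_coord_sq_le (hk₀ : 0 < k₀) (hν : 0 < ν) {T : ℝ} {a : ℕ → ℝ}
    (ha : ∀ s, 0 ≤ s → s ≤ T → ∀ n, w s n ^ 2 ≤ a n) {t : ℝ} (ht : 0 ≤ t) (htT : t ≤ T) (n : ℕ) :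
    (w t n - ν * wave k₀ (n + 1) ^ 2 *
      duhamel (ν * wave k₀ (n + 1) ^ 2) (fun s => w s n) t) ^ 2 ≤ 4 * a n := by
  have hw := wave_pos hk₀ (n + 1)
  have h0 : 0 ≤ a n := (sq_nonneg _).trans (ha t ht htT n)
  have h1 : ∀ s, 0 ≤ s → s ≤ T → |w s n| ≤ √(a n) := fun s hs hsT =>
    Real.abs_le_sqrt (ha s hs hsT n)
  have h2 := abs_duhamel_le (lam := ν * wave k₀ (n + 1) ^ 2) (f := fun s => w s n) (by positivity)
    ht fun s hs hst => h1 s hs (hst.trans htT)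
  have h3 : |w t n - ν * wave k₀ (n + 1) ^ 2 *
      duhamel (ν * wave k₀ (n + 1) ^ 2) (fun s => w s n) t| ≤ 2 * √(a n) := by
    refine (abs_sub _ _).trans ?_
    rw [abs_mul, abs_of_pos (show 0 < ν * wave k₀ (n + 1) ^ 2 by positivity)]
    linarith [h1 t ht htT]
  rw [← sq_abs]
  refine (pow_le_pow_left₀ (abs_nonneg _) h3 2).trans_eq ?_
  rw [mul_pow, Real.sq_sqrt h0]
  norm_num

lemma ouPath_apply (hk₀ : 0 < k₀) (hν : 0 < ν) (hdom : IsShellDominated w) (t : ℝ) (n : ℕ) :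
    ouPath k₀ ν w t n = w (max t 0) n - ν * wave k₀ (n + 1) ^ 2 *
      duhamel (ν * wave k₀ (n + 1) ^ 2) (fun s => w s n) (max t 0) := by
  obtain ⟨a, ha, hb⟩ := hdom (max t 0)
  exact toH_apply (Summable.of_nonneg_of_le (fun _ => sq_nonneg _)
    (fun n => ouPath_coord_sq_le hk₀ hν hb (le_max_right t 0) le_rfl n) (ha.mul_left 4)) n

lemma continuous_ouPath (hk₀ : 0 < k₀) (hν : 0 < ν) (hw : Continuous w)
    (hdom : IsShellDominated w) : Continuous (ouPath k₀ ν w) := by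
  have hwn : ∀ n, Continuous fun s => w s n := fun n => (continuous_apply n).comp hw
  refine continuous_iff_continuousAt.2 fun t => ?_
  obtain ⟨a, ha, hb⟩ := hdom (max (t + 1) 0)
  have hm : Continuous fun t : ℝ => max t 0 := continuous_id.max continuous_const
  refine continuousAt_of_apply (fun n => ?_) (ha.mul_left 4) ?_
  · simp_rw [ouPath_apply hk₀ hν hdom]
    exact (((hwn n).comp hm).sub
      (((continuous_duhamel (hwn n)).comp hm).const_mul _)).continuousAt
  · filter_upwards [Iio_mem_nhds (lt_add_one t)] with y hy n
    rw [ouPath_apply hk₀ hν hdom]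
    exact ouPath_coord_sq_le hk₀ hν hb (le_max_right y 0) (max_le_max_right 0 (le_of_lt hy)) n

/-- The path `e^{-ν t A} u₀`, with time cut off at `0`. -/
def decay (k₀ ν : ℝ) (u₀ : H) (t : ℝ) : H :=
  toH fun n => Real.exp (-(ν * wave k₀ (n + 1) ^ 2 * max t 0)) * u₀ n

lemma decay_coord_sq_le (hν : 0 < ν) (u₀ : H) (t : ℝ) (n : ℕ) :
    (Real.exp (-(ν * wave k₀ (n + 1) ^ 2 * max t 0)) * u₀ n) ^ 2 ≤ u₀ n ^ 2 := by
  have h := le_max_right t 0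
  have h1 : Real.exp (-(ν * wave k₀ (n + 1) ^ 2 * max t 0)) ≤ 1 :=
    Real.exp_le_one_iff.2 (neg_nonpos.2 (by positivity))
  rw [mul_pow]
  exact mul_le_of_le_one_left (sq_nonneg _) (pow_le_one₀ (Real.exp_pos _).le h1)

lemma decay_apply (hν : 0 < ν) (u₀ : H) (t : ℝ) (n : ℕ) :
    decay k₀ ν u₀ t n = Real.exp (-(ν * wave k₀ (n + 1) ^ 2 * max t 0)) * u₀ n :=
  toH_apply (Summable.of_nonneg_of_le (fun _ => sq_nonneg _) (decay_coord_sq_le hν u₀ t)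
    (summable_sq u₀)) n

lemma continuous_decay (hν : 0 < ν) (u₀ : H) : Continuous (decay k₀ ν u₀) := by
  refine continuous_iff_continuousAt.2 fun t => ?_
  refine continuousAt_of_apply (fun n => ?_) (summable_sq u₀) (Eventually.of_forall fun y n => ?_)
  · simp_rw [decay_apply hν]
    exact Continuous.continuousAt (by fun_prop)
  · rw [decay_apply hν]
    exact decay_coord_sq_le hν u₀ y n

/-- The solution of the linear equation `du + ν A u dt = dw`, `u(0) = u₀`. -/
def linearPath (k₀ ν : ℝ) (u₀ : H) (w : ℝ → H) (t : ℝ) : H := decay k₀ ν u₀ t + ouPath k₀ ν w t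

lemma continuous_linearPath (hk₀ : 0 < k₀) (hν : 0 < ν) (hw : Continuous w)
    (hdom : IsShellDominated w) : Continuous (linearPath k₀ ν u₀ w) :=
  (continuous_decay hν u₀).add (continuous_ouPath hk₀ hν hw hdom)

/-- The shell `n` of the difference of a mild solution with drift `f` and `ouPath`. -/
def driftShell (k₀ ν : ℝ) (u₀ : H) (f : ℝ → H) (n : ℕ) (t : ℝ) : ℝ :=
  Real.exp (-(ν * wave k₀ (n + 1) ^ 2 * t)) * u₀ n +
    duhamel (ν * wave k₀ (n + 1) ^ 2) (fun s => wave k₀ (n + 1) * f s n) t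

variable {f U : ℝ → H}

lemma driftShell_zero (n : ℕ) : driftShell k₀ ν u₀ f n 0 = u₀ n := by
  simp [driftShell]

/-- With the noise subtracted, ordinary calculus applies. `driftShell` has no cutoff at time `0`, so
it is differentiable on all of `ℝ`. -/
lemma hasDerivAt_driftShell (hf : Continuous f) (n : ℕ) (t : ℝ) :
    HasDerivAt (driftShell k₀ ν u₀ f n)
      (wave k₀ (n + 1) * f t n - ν * wave k₀ (n + 1) ^ 2 * driftShell k₀ ν u₀ f n t) t := by
  have hfn : Continuous fun s => f s n := (continuous_apply n).comp hf
  have h := ((((hasDerivAt_id t).const_mul (ν * wave k₀ (n + 1) ^ 2)).neg.exp).mul_const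
    (u₀ n)).add (hasDerivAt_duhamel (lam := ν * wave k₀ (n + 1) ^ 2)
      (f := fun s => wave k₀ (n + 1) * f s n) (by fun_prop) t)
  refine h.congr_deriv ?_
  simp only [driftShell, Pi.neg_apply, id]
  ring

lemma mild_apply (hk₀ : 0 < k₀) (hν : 0 < ν) (hf : Continuous f) {t : ℝ} (ht : 0 ≤ t)
    (hU : U t = linearPath k₀ ν u₀ w t + smoothing k₀ ν f t) (n : ℕ) :
    U t n = driftShell k₀ ν u₀ f n t + ouPath k₀ ν w t n := by
  rw [hU, linearPath, H.add_apply, H.add_apply, decay_apply hν, smoothing_apply hk₀ hν hf,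
    max_eq_left ht, driftShell]
  ring

/-- A mild solution satisfies the integral equation in every shell. -/
lemma mild_shell_eq (hk₀ : 0 < k₀) (hν : 0 < ν) (hw : Continuous w) (hdom : IsShellDominated w)
    (hf : Continuous f) (hUc : Continuous U)
    (hU : ∀ t, 0 ≤ t → U t = linearPath k₀ ν u₀ w t + smoothing k₀ ν f t) {t : ℝ} (ht : 0 ≤ t)
    (n : ℕ) :
    U t n = u₀ n - ν * wave k₀ (n + 1) ^ 2 * (∫ s in (0 : ℝ)..t, U s n) +
      wave k₀ (n + 1) * (∫ s in (0 : ℝ)..t, f s n) + w t n := by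
  have hfn : Continuous fun s => f s n := (continuous_apply n).comp hf
  have hwn : Continuous fun s => w s n := (continuous_apply n).comp hw
  have hUn : Continuous fun s => U s n := (continuous_apply n).comp hUc
  set lam := ν * wave k₀ (n + 1) ^ 2 with hlam
  -- By `h0` this function has derivative `0` at positive times; monotonicity of it and of its
  -- negative makes it constant.
  have hd : ∀ s, HasDerivAt (fun s => driftShell k₀ ν u₀ f n s - lam * duhamel lam (fun s => w s n) s
      + lam * (∫ r in (0 : ℝ)..s, U r n) - wave k₀ (n + 1) * ∫ r in (0 : ℝ)..s, f r n) _ s :=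
    fun s => (((hasDerivAt_driftShell hf n s).sub
      ((hasDerivAt_duhamel (lam := lam) hwn s).const_mul lam)).add
      ((hasDerivAt_integral hUn s).const_mul lam)).sub
      ((hasDerivAt_integral hfn s).const_mul (wave k₀ (n + 1)))
  have h0 : ∀ s, 0 ≤ s → U s n = driftShell k₀ ν u₀ f n s +
      (w s n - lam * duhamel lam (fun s => w s n) s) := fun s hs => by
    rw [mild_apply hk₀ hν hf hs (hU s hs) n, ouPath_apply hk₀ hν hdom, max_eq_left hs]
  have h1 := le_of_hasDerivAt_nonpos hd ht fun s hs => by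
    rw [h0 s hs.le]
    exact le_of_eq (by ring)
  have h2 := le_of_hasDerivAt_nonpos (fun s => (hd s).neg) ht fun s hs => by
    rw [h0 s hs.le]
    exact le_of_eq (by ring)
  simp only [driftShell_zero, duhamel_at_zero, intervalIntegral.integral_same, mul_zero,
    sub_zero, add_zero, Pi.neg_apply] at h1 h2
  have h3 := h0 t ht
  linarith

end LinearPart

/-! ### The energy estimate, uniform in the truncation radius. -/

section Energy

variable {k₀ ν : ℝ} {u₀ : H} {w U : ℝ → H}

/-- The energy leaving one shell enters the next, so the sum telescopes to the flux out of the last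
shell. -/
lemma sum_bilSeq_mul_self (k₀ : ℝ) (u v : ℕ → ℝ) (N : ℕ) :
    ∑ n ∈ Finset.range (N + 1), wave k₀ (n + 1) * bilSeq u v n * v n =
      -(wave k₀ (N + 1) * u N * v (N + 1) * v N) := by
  induction N with
  | zero => simp only [zero_add, Finset.sum_range_one, bilSeq]; ring
  | succ N ih =>
    rw [Finset.sum_range_succ, ih]
    simp only [bilSeq, wave]
    ring

/-- Of the dissipation `2ν k_n² v_n²`, with `v = u - z`, one half absorbs the pairing with `bilSeq u
z`. The other half, in the last shell, absorbs the boundary flux and leaves the term in `v_{N+1}²`.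
-/
lemma energy_rate_le (hν : 0 < ν) (u z : H) {c : ℝ} (hc0 : 0 ≤ c) (hc1 : c ≤ 1) (N : ℕ) :
    ∑ n ∈ Finset.range (N + 1), 2 * (u - z) n *
      (wave k₀ (n + 1) * (c * bilSeq u u n) - ν * wave k₀ (n + 1) ^ 2 * (u - z) n) ≤
      1 / ν * (4 * (‖u‖ ^ 2 * ‖z‖ ^ 2)) + 1 / ν * (‖u‖ ^ 2 * (u - z) (N + 1) ^ 2) := by
  set v : H := u - z with hv
  have young : ∀ x y d : ℝ, |d| ≤ 1 → 2 * d * (x * y) ≤ ν * x ^ 2 + 1 / ν * y ^ 2 := by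
    intro x y d hd
    have h1 : 2 * |x * y| ≤ ν * x ^ 2 + 1 / ν * y ^ 2 := by
      have h2 : 0 ≤ 1 / ν * (ν * |x| - |y|) ^ 2 := by positivity
      have h3 : 1 / ν * (ν * |x| - |y|) ^ 2 = ν * |x| ^ 2 + 1 / ν * |y| ^ 2 - 2 * (|x| * |y|) := by
        field_simp
        ring
      rw [sq_abs, sq_abs] at h3
      rw [abs_mul]
      linarith
    have h4 : d * (x * y) ≤ 1 * |x * y| :=
      (le_abs_self _).trans ((abs_mul d _).trans_le
        (mul_le_mul_of_nonneg_right hd (abs_nonneg _)))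
    linarith
  have hcabs : |c| ≤ 1 := abs_le.2 ⟨by linarith, hc1⟩
  have hsplit : ∀ n, bilSeq u u n = bilSeq u v n + bilSeq u z n := by
    intro n
    cases n <;> simp only [bilSeq, hv, H.sub_apply] <;> ring
  have hterm : ∀ n, 2 * v n *
      (wave k₀ (n + 1) * (c * bilSeq u u n) - ν * wave k₀ (n + 1) ^ 2 * v n) ≤
      2 * c * (wave k₀ (n + 1) * bilSeq u v n * v n) +
        (1 / ν * bilSeq u z n ^ 2 - ν * (wave k₀ (n + 1) * v n) ^ 2) := by
    intro n
    have := young (wave k₀ (n + 1) * v n) (bilSeq u z n) c hcabs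
    rw [hsplit n]
    nlinarith
  refine (Finset.sum_le_sum fun n _ => hterm n).trans ?_
  rw [Finset.sum_add_distrib, Finset.sum_sub_distrib, ← Finset.mul_sum, ← Finset.mul_sum,
    ← Finset.mul_sum, sum_bilSeq_mul_self]
  have h1 : 1 / ν * ∑ n ∈ Finset.range (N + 1), bilSeq u z n ^ 2 ≤
      1 / ν * (4 * (‖u‖ ^ 2 * ‖z‖ ^ 2)) :=
    mul_le_mul_of_nonneg_left (sum_bilSeq_sq_le u z (N + 1)) (by positivity)
  have h2 : (wave k₀ (N + 1) * v N) ^ 2 ≤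
      ∑ n ∈ Finset.range (N + 1), (wave k₀ (n + 1) * v n) ^ 2 :=
    Finset.single_le_sum (f := fun n => (wave k₀ (n + 1) * v n) ^ 2) (fun n _ => sq_nonneg _)
      (Finset.self_mem_range_succ N)
  have h3 := young (wave k₀ (N + 1) * v N) (u N * v (N + 1)) (-c) (by rwa [abs_neg])
  have h4 : 1 / ν * (u N * v (N + 1)) ^ 2 ≤ 1 / ν * (‖u‖ ^ 2 * v (N + 1) ^ 2) := by
    rw [mul_pow]
    exact mul_le_mul_of_nonneg_left (mul_le_mul_of_nonneg_right (sq_apply_le_norm_sq u N)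
      (sq_nonneg _)) (by positivity)
  have h5 := mul_le_mul_of_nonneg_left h2 hν.le
  nlinarith

/-- This removes the boundary flux: coordinates of a fixed vector tend to `0`, and the norms provide
domination in time. -/
lemma tendsto_integral_norm_sq_mul_apply {x y : ℝ → H} (hx : Continuous x) (hy : Continuous y)
    (t : ℝ) : Tendsto (fun N : ℕ => ∫ s in (0 : ℝ)..t, ‖x s‖ ^ 2 * y s (N + 1) ^ 2) atTop
      (𝓝 0) := by
  have hyn : ∀ n, Continuous fun s => y s n := fun n => (continuous_apply n).comp hy
  have h := intervalIntegral.tendsto_integral_filter_of_dominated_convergence (μ := volume)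
    (a := 0) (b := t) (l := atTop) (F := fun (N : ℕ) s => ‖x s‖ ^ 2 * y s (N + 1) ^ 2)
    (f := fun _ => 0) (fun s => ‖x s‖ ^ 2 * ‖y s‖ ^ 2)
    (Eventually.of_forall fun N => ?_) (Eventually.of_forall fun N => ?_)
    (Continuous.intervalIntegrable (by fun_prop) _ _) (Eventually.of_forall fun s _ => ?_)
  · simpa using h
  · have := hyn (N + 1)
    exact Continuous.aestronglyMeasurable (by fun_prop)
  · refine Eventually.of_forall fun s _ => ?_
    rw [Real.norm_of_nonneg (by positivity)]
    exact mul_le_mul_of_nonneg_left (sq_apply_le_norm_sq _ _) (sq_nonneg _)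
  · have h1 := ((tendsto_add_atTop_iff_nat 1).2 (tendsto_apply_zero (y s))).pow 2
    simpa using h1.const_mul (‖x s‖ ^ 2)

/-- The energy inequality for the difference of a solution of the truncated equation and
`ouPath`. -/
lemma energy_le (hk₀ : 0 < k₀) (hν : 0 < ν) (hw : Continuous w) (hdom : IsShellDominated w)
    {R : ℝ} (hR : 0 < R) (hUc : Continuous U)
    (hU : ∀ t, 0 ≤ t →
      U t = linearPath k₀ ν u₀ w t + smoothing k₀ ν (fun s => truncBil R (U s)) t)
    {t : ℝ} (ht : 0 ≤ t) :
    ‖U t - ouPath k₀ ν w t‖ ^ 2 ≤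
      ‖u₀‖ ^ 2 + ∫ s in (0 : ℝ)..t, 1 / ν * (4 * (‖U s‖ ^ 2 * ‖ouPath k₀ ν w s‖ ^ 2)) := by
  have hz := continuous_ouPath hk₀ hν hw hdom
  have hfc : Continuous fun s => truncBil R (U s) :=
    (continuous_of_lipschitz (norm_truncBil_sub_le hR)).comp hUc
  set z := ouPath k₀ ν w with hzdef
  have hv : Continuous fun s => U s - z s := hUc.sub hz
  have hvn : ∀ n, Continuous fun s => (U s - z s) n := fun n => (continuous_apply n).comp hv
  set D := driftShell k₀ ν u₀ (fun s => truncBil R (U s)) with hD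
  have hDv : ∀ s, 0 ≤ s → ∀ n, D n s = (U s - z s) n := fun s hs n => by
    rw [H.sub_apply, mild_apply hk₀ hν hfc hs (hU s hs) n]
    ring
  have key : ∀ N : ℕ, ∑ n ∈ Finset.range (N + 1), (U t - z t) n ^ 2 ≤ ‖u₀‖ ^ 2 +
      ((∫ s in (0 : ℝ)..t, 1 / ν * (4 * (‖U s‖ ^ 2 * ‖z s‖ ^ 2))) +
        1 / ν * ∫ s in (0 : ℝ)..t, ‖U s‖ ^ 2 * (U s - z s) (N + 1) ^ 2) := by
    intro N
    have hN := hvn (N + 1)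
    have hd : ∀ s, HasDerivAt (fun s => ∑ n ∈ Finset.range (N + 1), D n s ^ 2 -
        ((∫ s in (0 : ℝ)..s, 1 / ν * (4 * (‖U s‖ ^ 2 * ‖z s‖ ^ 2))) +
          1 / ν * ∫ s in (0 : ℝ)..s, ‖U s‖ ^ 2 * (U s - z s) (N + 1) ^ 2)) _ s := fun s =>
      (HasDerivAt.fun_sum fun n _ => (hasDerivAt_driftShell hfc n s).pow 2).sub
        ((hasDerivAt_integral (by fun_prop) s).add
          ((hasDerivAt_integral (f := fun s => ‖U s‖ ^ 2 * (U s - z s) (N + 1) ^ 2)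
            (by fun_prop) s).const_mul (1 / ν)))
    have h := le_of_hasDerivAt_nonpos hd ht fun s hs => by
      have hm : 0 < max R ‖U s‖ := lt_max_of_lt_left hR
      have hc1 : (R / max R ‖U s‖) ^ 2 ≤ 1 :=
        pow_le_one₀ (by positivity) ((div_le_one hm).2 (le_max_left _ _))
      have h1 := energy_rate_le (k₀ := k₀) hν (U s) (z s) (sq_nonneg _) hc1 N
      rw [sub_nonpos]
      refine le_trans (le_of_eq (Finset.sum_congr rfl fun n _ => ?_)) h1
      rw [← hD, hDv s hs.le n, truncBil_eq_smul, H.smul_apply, bil_apply]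
      simp
    simp only [intervalIntegral.integral_same, mul_zero, add_zero, sub_zero] at h
    simp only [hDv t ht] at h
    have h0 : ∑ n ∈ Finset.range (N + 1), D n 0 ^ 2 ≤ ‖u₀‖ ^ 2 := by
      simp only [hD, driftShell_zero]
      exact sum_range_sq_le u₀ (N + 1)
    linarith
  have hl := ((tendsto_add_atTop_iff_nat 1).2 (hasSum_norm_sq (U t - z t)).tendsto_sum_nat)
  have hr := (((tendsto_integral_norm_sq_mul_apply hUc hv t).const_mul (1 / ν)).const_add
    (∫ s in (0 : ℝ)..t, 1 / ν * (4 * (‖U s‖ ^ 2 * ‖z s‖ ^ 2)))).const_add (‖u₀‖ ^ 2)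
  rw [mul_zero, add_zero] at hr
  exact le_of_tendsto_of_tendsto' hl hr key

/-- The solutions of the truncated equations are bounded on `[0, T]`, uniformly in the truncation
radius. -/
lemma exists_norm_le_of_truncated (hk₀ : 0 < k₀) (hν : 0 < ν) (hw : Continuous w)
    (hdom : IsShellDominated w) (u₀ : H) (T : ℝ) :
    ∃ M : ℝ, ∀ R, 0 < R → ∀ U : ℝ → H, Continuous U → (∀ t, 0 ≤ t →
      U t = linearPath k₀ ν u₀ w t + smoothing k₀ ν (fun s => truncBil R (U s)) t) →
      ∀ t, 0 ≤ t → t ≤ T → ‖U t‖ ≤ M := by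
  have hz := continuous_ouPath hk₀ hν hw hdom
  obtain ⟨Z, hZ⟩ := isCompact_Icc.exists_bound_of_continuousOn (s := Set.Icc 0 T) hz.continuousOn
  set a := ‖u₀‖ ^ 2 + 8 / ν * Z ^ 4 * T with ha
  set c := 8 / ν * Z ^ 2 with hc
  have hc0 : 0 ≤ c := by positivity
  refine ⟨√(a * Real.exp (c * T)) + Z, fun R hR U hUc hU t ht htT => ?_⟩
  have hT : 0 ≤ T := ht.trans htT
  set z := ouPath k₀ ν w with hzdef
  have hvc : Continuous fun s => ‖U s - z s‖ ^ 2 := by fun_prop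
  have hg := le_mul_exp_of_le_integral hvc (a := a) (c := c) (T := T) hc0 (fun t ht htT => ?_)
    ht htT
  · have ha0 : 0 ≤ a := by positivity
    have h1 : ‖U t - z t‖ ≤ √(a * Real.exp (c * T)) := by
      refine Real.le_sqrt_of_sq_le (hg.trans (mul_le_mul_of_nonneg_left
        (Real.exp_le_exp.2 (mul_le_mul_of_nonneg_left htT hc0)) ha0))
    have h2 : ‖U t‖ ≤ ‖U t - z t‖ + ‖z t‖ := by
      simpa using norm_add_le (U t - z t) (z t)
    linarith [hZ t ⟨ht, htT⟩]
  · refine (energy_le hk₀ hν hw hdom hR hUc hU ht).trans ?_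
    have h1 : ∫ s in (0 : ℝ)..t, 1 / ν * (4 * (‖U s‖ ^ 2 * ‖z s‖ ^ 2)) ≤
        ∫ s in (0 : ℝ)..t, (8 / ν * Z ^ 4 + c * ‖U s - z s‖ ^ 2) := by
      refine intervalIntegral.integral_mono_on ht
        (Continuous.intervalIntegrable (by fun_prop) _ _)
        (Continuous.intervalIntegrable (by fun_prop) _ _) fun s hs => ?_
      have hzs : ‖z s‖ ≤ Z := hZ s ⟨hs.1, hs.2.trans htT⟩
      have hzs2 : ‖z s‖ ^ 2 ≤ Z ^ 2 := pow_le_pow_left₀ (norm_nonneg _) hzs 2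
      have h2 : ‖U s‖ ≤ ‖U s - z s‖ + ‖z s‖ := by
        simpa using norm_add_le (U s - z s) (z s)
      -- Returning from `u` to `v = u - z` makes the energy inequality linear in `‖v‖²`, as Gronwall
      -- requires.
      have h3 : ‖U s‖ ^ 2 ≤ 2 * ‖U s - z s‖ ^ 2 + 2 * Z ^ 2 := by
        have := pow_le_pow_left₀ (norm_nonneg _) h2 2
        nlinarith [sq_nonneg (‖U s - z s‖ - ‖z s‖)]
      have h4 : ‖U s‖ ^ 2 * ‖z s‖ ^ 2 ≤ (2 * ‖U s - z s‖ ^ 2 + 2 * Z ^ 2) * Z ^ 2 :=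
        mul_le_mul h3 hzs2 (sq_nonneg _) (by positivity)
      calc 1 / ν * (4 * (‖U s‖ ^ 2 * ‖z s‖ ^ 2))
          ≤ 1 / ν * (4 * ((2 * ‖U s - z s‖ ^ 2 + 2 * Z ^ 2) * Z ^ 2)) := by gcongr
        _ = 8 / ν * Z ^ 4 + c * ‖U s - z s‖ ^ 2 := by rw [hc]; ring
    have h6 : ∫ s in (0 : ℝ)..t, (8 / ν * Z ^ 4 + c * ‖U s - z s‖ ^ 2) =
        (t - 0) • (8 / ν * Z ^ 4) + c * ∫ s in (0 : ℝ)..t, ‖U s - z s‖ ^ 2 := by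
      rw [intervalIntegral.integral_add (Continuous.intervalIntegrable (by fun_prop) _ _)
        (Continuous.intervalIntegrable (by fun_prop) _ _), intervalIntegral.integral_const,
        intervalIntegral.integral_const_mul]
    have h5 : (t - 0) • (8 / ν * Z ^ 4) ≤ 8 / ν * Z ^ 4 * T := by
      rw [sub_zero, smul_eq_mul, mul_comm]
      exact mul_le_mul_of_nonneg_left htT (by positivity)
    rw [ha]
    linarith

end Energy

/-! ### Removal of the truncation. -/

section Solution

variable {k₀ ν : ℝ} {u₀ : H} {w : ℝ → H}

/-- The solution of the equation truncated at radius `R`. -/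
def truncSol (k₀ ν R : ℝ) (u₀ : H) (w : ℝ → H) : ℝ → H :=
  picardLim k₀ ν (truncBil R) (linearPath k₀ ν u₀ w)

/-- The solution of the shell model driven by the path `w`. -/
def shellSol (k₀ ν : ℝ) (u₀ : H) (w : ℝ → H) (t : ℝ) : H :=
  limUnder atTop fun m : ℕ => truncSol k₀ ν (m + 1) u₀ w t

variable {R : ℝ}

lemma continuous_truncSol (hk₀ : 0 < k₀) (hν : 0 < ν) (hw : Continuous w)
    (hdom : IsShellDominated w) (hR : 0 < R) : Continuous (truncSol k₀ ν R u₀ w) :=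
  continuous_picardLim hk₀ hν (norm_truncBil_sub_le hR) (continuous_linearPath hk₀ hν hw hdom)

lemma truncSol_eq (hk₀ : 0 < k₀) (hν : 0 < ν) (hw : Continuous w)
    (hdom : IsShellDominated w) (hR : 0 < R) (t : ℝ) :
    truncSol k₀ ν R u₀ w t = linearPath k₀ ν u₀ w t +
      smoothing k₀ ν (fun s => truncBil R (truncSol k₀ ν R u₀ w s)) t :=
  picardLim_eq hk₀ hν (norm_truncBil_sub_le hR) (continuous_linearPath hk₀ hν hw hdom) t

/-- Once the radius exceeds the uniform bound, the solution never meets the truncation on `[0,T]`.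
It therefore solves the equation for every larger radius, and uniqueness applies. -/
lemma exists_truncSol_stable (hk₀ : 0 < k₀) (hν : 0 < ν) (hw : Continuous w)
    (hdom : IsShellDominated w) (u₀ : H) (T : ℝ) :
    ∃ m₀ : ℕ, ∀ t, 0 ≤ t → t ≤ T → ‖truncSol k₀ ν (m₀ + 1) u₀ w t‖ ≤ m₀ + 1 ∧
      ∀ m : ℕ, m₀ ≤ m → truncSol k₀ ν (m + 1) u₀ w t = truncSol k₀ ν (m₀ + 1) u₀ w t := by
  obtain ⟨M, hM⟩ := exists_norm_le_of_truncated hk₀ hν hw hdom u₀ T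
  have hpos : ∀ m : ℕ, (0 : ℝ) < m + 1 := fun m => by positivity
  have hle : ∀ m : ℕ, ⌈M⌉₊ ≤ m → M ≤ m + 1 := fun m hm => by
    have h1 : (⌈M⌉₊ : ℝ) ≤ m := by exact_mod_cast hm
    linarith [Nat.le_ceil M]
  have hb : ∀ m : ℕ, ∀ t, 0 ≤ t → t ≤ T → ‖truncSol k₀ ν (m + 1) u₀ w t‖ ≤ M := fun m =>
    hM _ (hpos m) _ (continuous_truncSol hk₀ hν hw hdom (hpos m)) fun t _ =>
      truncSol_eq hk₀ hν hw hdom (hpos m) t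
  refine ⟨⌈M⌉₊, fun t ht htT => ⟨(hb _ t ht htT).trans (hle _ le_rfl), fun m hm => ?_⟩⟩
  refine eqOn_of_eq_add_smoothing hk₀ hν (norm_truncBil_sub_le (hpos m))
    (continuous_truncSol hk₀ hν hw hdom (hpos m)) (continuous_truncSol hk₀ hν hw hdom (hpos _))
    (fun t _ _ => truncSol_eq hk₀ hν hw hdom (hpos m) t) (fun t ht htT => ?_) ht htT
  rw [truncSol_eq hk₀ hν hw hdom (hpos _) t]
  congr 1
  refine smoothing_congr ht fun s hs hst => ?_
  have h := hb ⌈M⌉₊ s hs (hst.trans htT)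
  rw [truncBil_of_norm_le (hpos _) (h.trans (hle _ le_rfl)),
    truncBil_of_norm_le (hpos _) (h.trans (hle _ hm))]

lemma tendsto_truncSol (hk₀ : 0 < k₀) (hν : 0 < ν) (hw : Continuous w)
    (hdom : IsShellDominated w) {t : ℝ} (ht : 0 ≤ t) :
    Tendsto (fun m : ℕ => truncSol k₀ ν (m + 1) u₀ w t) atTop (𝓝 (shellSol k₀ ν u₀ w t)) := by
  obtain ⟨m₀, h⟩ := exists_truncSol_stable hk₀ hν hw hdom u₀ t
  refine tendsto_nhds_limUnder ⟨truncSol k₀ ν (m₀ + 1) u₀ w t, tendsto_const_nhds.congr' ?_⟩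
  filter_upwards [eventually_ge_atTop m₀] with m hm
  exact ((h t ht le_rfl).2 m hm).symm

/-- On `[0, T]` the path `shellSol` agrees with a continuous path which satisfies the integral
equation in every shell. -/
lemma exists_shellSol_eq (hk₀ : 0 < k₀) (hν : 0 < ν) (hw : Continuous w) (hw0 : w 0 = 0)
    (hdom : IsShellDominated w) (u₀ : H) (T : ℝ) :
    ∃ U : ℝ → H, Continuous U ∧ U 0 = u₀ ∧
      (∀ t, 0 ≤ t → t ≤ T → shellSol k₀ ν u₀ w t = U t) ∧
      ∀ t, 0 ≤ t → t ≤ T → ∀ n,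
        U t n = u₀ n - ν * wave k₀ (n + 1) ^ 2 * (∫ s in (0 : ℝ)..t, U s n) +
          wave k₀ (n + 1) * (∫ s in (0 : ℝ)..t, bil (U s) (U s) n) + w t n := by
  obtain ⟨m₀, h⟩ := exists_truncSol_stable hk₀ hν hw hdom u₀ T
  have hpos : (0 : ℝ) < m₀ + 1 := by positivity
  have hc := continuous_truncSol (u₀ := u₀) hk₀ hν hw hdom hpos
  have hfc : Continuous fun s => truncBil (m₀ + 1) (truncSol k₀ ν (m₀ + 1) u₀ w s) :=
    (continuous_of_lipschitz (norm_truncBil_sub_le hpos)).comp hc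
  have key := fun (t : ℝ) (ht : 0 ≤ t) (n : ℕ) => mild_shell_eq hk₀ hν hw hdom hfc hc
    (fun t _ => truncSol_eq hk₀ hν hw hdom hpos t) ht n
  refine ⟨truncSol k₀ ν (m₀ + 1) u₀ w, hc, ?_, fun t ht htT => ?_, fun t ht htT n => ?_⟩
  · ext n
    rw [key 0 le_rfl n, hw0]
    simp
  · refine tendsto_nhds_unique (tendsto_truncSol hk₀ hν hw hdom ht) (tendsto_const_nhds.congr' ?_)
    filter_upwards [eventually_ge_atTop m₀] with m hm
    exact ((h t ht htT).2 m hm).symm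
  · rw [key t ht n]
    congr 3
    refine intervalIntegral.integral_congr fun s hs => ?_
    rw [Set.uIcc_of_le ht] at hs
    simp only [truncBil_of_norm_le hpos (h s hs.1 (hs.2.trans htT)).1]

end Solution

/-! ### Measurable dependence on the driving path. -/

section Measurability

variable {Ω : Type*} {mΩ : MeasurableSpace Ω} {T : ℝ}

lemma measurable_integral_of_continuous {h : ℝ → Ω → ℝ} (hc : ∀ ω, Continuous fun s => h s ω)
    (hm : ∀ s, 0 ≤ s → s ≤ T → Measurable (h s)) {t : ℝ} (ht : 0 ≤ t) (htT : t ≤ T) :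
    Measurable fun ω => ∫ s in (0 : ℝ)..t, h s ω := by
  have hT : 0 ≤ T := ht.trans htT
  -- Only times in `[0,T]` give measurable integrands; clamping `s` makes the integrand jointly
  -- measurable without changing the integral.
  have e : (fun ω => ∫ s in (0 : ℝ)..t, h s ω) =
      fun ω => ∫ s in (0 : ℝ)..t, h (max 0 (min s T)) ω := by
    ext ω
    refine intervalIntegral.integral_congr fun s hs => ?_
    rw [Set.uIcc_of_le ht] at hs
    simp only [min_eq_left (hs.2.trans htT), max_eq_right hs.1]
  have hu : StronglyMeasurable (Function.uncurry fun s ω => h (max 0 (min s T)) ω) :=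
    stronglyMeasurable_uncurry_of_continuous_of_stronglyMeasurable
      (fun ω => (hc ω).comp (by fun_prop)) fun s =>
        (hm _ (le_max_left _ _) (max_le hT (min_le_right _ _))).stronglyMeasurable
  rw [e]
  simp_rw [intervalIntegral.integral_of_le ht]
  exact (hu.integral_prod_left (μ := volume.restrict (Set.Ioc 0 t))).measurable

lemma measurable_duhamel {lam : ℝ} {h : ℝ → Ω → ℝ} (hc : ∀ ω, Continuous fun s => h s ω)
    (hm : ∀ s, 0 ≤ s → s ≤ T → Measurable (h s)) {t : ℝ} (ht : 0 ≤ t) (htT : t ≤ T) :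
    Measurable fun ω => duhamel lam (fun s => h s ω) t := by
  unfold duhamel
  refine (measurable_integral_of_continuous (h := fun s ω => Real.exp (lam * s) * h s ω)
    (fun ω => ?_) (fun s hs hsT => (hm s hs hsT).const_mul _) ht htT).const_mul _
  have := hc ω
  fun_prop

lemma measurable_apply {f : Ω → H} (hf : StronglyMeasurable f) (n : ℕ) :
    Measurable fun ω => f ω n :=
  ((continuous_apply n).comp_stronglyMeasurable hf).measurable

variable {k₀ ν : ℝ}

lemma stronglyMeasurable_smoothing (hk₀ : 0 < k₀) (hν : 0 < ν) {f : ℝ → Ω → H}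
    (hc : ∀ ω, Continuous fun s => f s ω)
    (hm : ∀ s, 0 ≤ s → s ≤ T → StronglyMeasurable (f s)) {t : ℝ} (ht : 0 ≤ t) (htT : t ≤ T) :
    StronglyMeasurable fun ω => smoothing k₀ ν (fun s => f s ω) t := by
  refine stronglyMeasurable_of_apply fun n => ?_
  simp_rw [smoothing_apply hk₀ hν (hc _), max_eq_left ht]
  exact measurable_duhamel (h := fun s ω => wave k₀ (n + 1) * f s ω n)
    (fun ω => ((continuous_apply n).comp (hc ω)).const_mul _)
    (fun s hs hsT => (measurable_apply (hm s hs hsT) n).const_mul _) ht htT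

lemma stronglyMeasurable_picard (hk₀ : 0 < k₀) (hν : 0 < ν) {β : H → H} (hβ : Continuous β)
    {g : ℝ → Ω → H} (hc : ∀ ω, Continuous fun s => g s ω)
    (hm : ∀ s, 0 ≤ s → s ≤ T → StronglyMeasurable (g s)) (j : ℕ) {t : ℝ} (ht : 0 ≤ t)
    (htT : t ≤ T) : StronglyMeasurable fun ω => picard k₀ ν β (fun s => g s ω) j t := by
  induction j generalizing t with
  | zero => exact hm t ht htT
  | succ j ih =>
    refine (hm t ht htT).add (stronglyMeasurable_smoothing hk₀ hν
      (f := fun s ω => β (picard k₀ ν β (fun s => g s ω) j s))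
      (fun ω => hβ.comp (continuous_picard hk₀ hν hβ (hc ω) j))
      (fun s hs hsT => hβ.comp_stronglyMeasurable (ih hs hsT)) ht htT)

variable {u₀ : Ω → H} {W : ℝ → Ω → H}

lemma stronglyMeasurable_linearPath (hk₀ : 0 < k₀) (hν : 0 < ν) (hu₀ : StronglyMeasurable u₀)
    (hc : ∀ ω, Continuous fun s => W s ω) (hdom : ∀ ω, IsShellDominated fun s => W s ω)
    (hm : ∀ s, 0 ≤ s → s ≤ T → StronglyMeasurable (W s)) {t : ℝ} (ht : 0 ≤ t) (htT : t ≤ T) :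
    StronglyMeasurable fun ω => linearPath k₀ ν (u₀ ω) (fun s => W s ω) t := by
  refine stronglyMeasurable_of_apply fun n => ?_
  simp_rw [linearPath, H.add_apply, decay_apply hν, ouPath_apply hk₀ hν (hdom _), max_eq_left ht]
  refine ((measurable_apply hu₀ n).const_mul _).add ((measurable_apply (hm t ht htT) n).sub
    (Measurable.const_mul ?_ _))
  exact measurable_duhamel (h := fun s ω => W s ω n) (fun ω => (continuous_apply n).comp (hc ω))
    (fun s hs hsT => measurable_apply (hm s hs hsT) n) ht htT

/-- The solution at time `t` depends measurably on the driving path up to time `t`. -/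
lemma stronglyMeasurable_shellSol (hk₀ : 0 < k₀) (hν : 0 < ν) (hu₀ : StronglyMeasurable u₀)
    (hc : ∀ ω, Continuous fun s => W s ω) (hdom : ∀ ω, IsShellDominated fun s => W s ω)
    {t : ℝ} (hm : ∀ s, 0 ≤ s → s ≤ t → StronglyMeasurable (W s)) (ht : 0 ≤ t) :
    StronglyMeasurable fun ω => shellSol k₀ ν (u₀ ω) (fun s => W s ω) t := by
  refine stronglyMeasurable_of_tendsto atTop (fun m : ℕ => ?_)
    (tendsto_pi_nhds.2 fun ω => tendsto_truncSol hk₀ hν (hc ω) (hdom ω) ht)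
  have hpos : (0 : ℝ) < m + 1 := by positivity
  exact stronglyMeasurable_of_tendsto atTop (fun j : ℕ =>
    stronglyMeasurable_picard hk₀ hν (continuous_of_lipschitz (norm_truncBil_sub_le hpos))
      (g := fun s ω => linearPath k₀ ν (u₀ ω) (fun s => W s ω) s)
      (fun ω => continuous_linearPath hk₀ hν (hc ω) (hdom ω))
      (fun s hs hst => stronglyMeasurable_linearPath hk₀ hν hu₀ hc hdom hm hs hst) j ht le_rfl)
    (tendsto_pi_nhds.2 fun ω => tendsto_picard hk₀ hν (norm_truncBil_sub_le hpos)
      (continuous_linearPath hk₀ hν (hc ω) (hdom ω)) t)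

end Measurability

/-! ### Dyadic chaining for scalar paths. -/

section Chaining

lemma abs_dyadic_le {x : ℝ → ℝ} (hx0 : x 0 = 0) {T : ℝ} {b : ℕ → ℝ} (hb : ∀ m, 0 ≤ b m)
    (h : ∀ m j : ℕ, j < 2 ^ m → |x ((j + 1) * (T / 2 ^ m)) - x (j * (T / 2 ^ m))| ≤ b m) (m : ℕ) :
    ∀ j : ℕ, j ≤ 2 ^ m → |x (j * (T / 2 ^ m))| ≤ ∑ i ∈ Finset.range (m + 1), b i := by
  induction m with
  | zero =>
    intro j hj
    have hj' : j = 0 ∨ j = 1 := by rw [pow_zero] at hj; omega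
    rw [zero_add, Finset.sum_range_one]
    rcases hj' with rfl | rfl
    · simpa [hx0] using hb 0
    · simpa [hx0] using h 0 0 (by norm_num)
  | succ m ih =>
    intro j hj
    rw [Finset.sum_range_succ]
    have e : ∀ k : ℕ, ((2 * k : ℕ) : ℝ) * (T / 2 ^ (m + 1)) = k * (T / 2 ^ m) := fun k => by
      push_cast
      rw [pow_succ]
      field_simp
    have hpow : 2 ^ (m + 1) = 2 * 2 ^ m := pow_succ' 2 m
    -- An even index is a point of the coarser grid; an odd one is one increment away from it.
    obtain ⟨k, rfl | rfl⟩ := Nat.even_or_odd' j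
    · rw [e]
      have := ih k (by omega)
      linarith [hb (m + 1)]
    · have h1 := ih k (by omega)
      have h2 := h (m + 1) (2 * k) (by omega)
      rw [e] at h2
      have h3 : ((2 * k + 1 : ℕ) : ℝ) = ((2 * k : ℕ) : ℝ) + 1 := by push_cast; ring
      rw [h3]
      have h4 := abs_sub_abs_le_abs_sub (x ((((2 * k : ℕ) : ℝ) + 1) * (T / 2 ^ (m + 1))))
        (x (k * (T / 2 ^ m)))
      linarith

/-- A continuous path is bounded by weighted sums of its dyadic increments. -/
lemma sq_le_tsum_of_dyadic {x : ℝ → ℝ} (hx : Continuous x) (hx0 : x 0 = 0) {T : ℝ} (hT : 0 < T)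
    {d : ℕ → ℝ} (hd : ∀ m, 0 ≤ d m) (hs : Summable fun m : ℕ => (5 / 4 : ℝ) ^ m * d m)
    (h : ∀ m j : ℕ, j < 2 ^ m →
      (x ((j + 1) * (T / 2 ^ m)) - x (j * (T / 2 ^ m))) ^ 2 ≤ d m) {s : ℝ} (hs0 : 0 ≤ s)
    (hsT : s ≤ T) : x s ^ 2 ≤ 5 * ∑' m : ℕ, (5 / 4 : ℝ) ^ m * d m := by
  have key : ∀ m j : ℕ, j ≤ 2 ^ m →
      x (j * (T / 2 ^ m)) ^ 2 ≤ 5 * ∑' m : ℕ, (5 / 4 : ℝ) ^ m * d m := by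
    intro m j hj
    have h1 := abs_dyadic_le hx0 (b := fun m => √(d m)) (fun m => Real.sqrt_nonneg _)
      (fun m j hj => Real.abs_le_sqrt (h m j hj)) m j hj
    -- Cauchy–Schwarz with weights `(4/5)^i` and `(5/4)^i`; the first geometric series sums to `5`.
    have h2 : (∑ i ∈ Finset.range (m + 1), √(d i)) ^ 2 ≤
        (∑ i ∈ Finset.range (m + 1), (4 / 5 : ℝ) ^ i) *
          ∑ i ∈ Finset.range (m + 1), (5 / 4 : ℝ) ^ i * d i := by
      refine Finset.sum_sq_le_sum_mul_sum_of_sq_le_mul _ (fun i _ => by positivity)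
        (fun i _ => mul_nonneg (by positivity) (hd i)) fun i _ => ?_
      rw [Real.sq_sqrt (hd i), ← mul_assoc, ← mul_pow]
      norm_num
    have hg : HasSum (fun i : ℕ => (4 / 5 : ℝ) ^ i) 5 := by
      have := hasSum_geometric_of_lt_one (r := (4 / 5 : ℝ)) (by norm_num) (by norm_num)
      norm_num at this
      exact this
    have h3 : ∑ i ∈ Finset.range (m + 1), (4 / 5 : ℝ) ^ i ≤ 5 :=
      sum_le_hasSum _ (fun i _ => by positivity) hg
    have h4 : ∑ i ∈ Finset.range (m + 1), (5 / 4 : ℝ) ^ i * d i ≤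
        ∑' m : ℕ, (5 / 4 : ℝ) ^ m * d m :=
      hs.sum_le_tsum _ fun i _ => mul_nonneg (by positivity) (hd i)
    rw [← sq_abs]
    refine (pow_le_pow_left₀ (abs_nonneg _) h1 2).trans (h2.trans ?_)
    exact mul_le_mul h3 h4 (Finset.sum_nonneg fun i _ => mul_nonneg (by positivity) (hd i))
      (by norm_num)
  have ht : Tendsto (fun m : ℕ => (⌊s / T * 2 ^ m⌋₊ : ℝ) * (T / 2 ^ m)) atTop (𝓝 s) := by
    have h1 : Tendsto (fun m : ℕ => (⌊s / T * (2 : ℝ) ^ m⌋₊ : ℝ) / 2 ^ m) atTop (𝓝 (s / T)) :=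
      (tendsto_nat_floor_mul_div_atTop (a := s / T) (by positivity)).comp
        (tendsto_pow_atTop_atTop_of_one_lt one_lt_two)
    have h2 := h1.mul_const T
    rw [div_mul_cancel₀ _ hT.ne'] at h2
    exact h2.congr fun m => by ring
  refine le_of_tendsto' (((hx.tendsto s).comp ht).pow 2) fun m => key m _ ?_
  refine Nat.floor_le_of_le ?_
  push_cast
  exact mul_le_of_le_one_left (by positivity) ((div_le_one hT).2 hsT)

end Chaining

/-! ### Summability from expectations, and Gaussian fourth moments. -/

section Moments

variable {Ω : Type*} {mΩ : MeasurableSpace Ω} {P : Measure Ω}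

lemma ae_summable_of_integral_le {ι : Type*} [Countable ι] {f : ι → Ω → ℝ}
    (hf0 : ∀ i ω, 0 ≤ f i ω) (hf : ∀ i, Integrable (f i) P) {c : ι → ℝ} (hc : Summable c)
    (h : ∀ i, ∫ ω, f i ω ∂P ≤ c i) : ∀ᵐ ω ∂P, Summable fun i => f i ω := by
  have hm : ∀ i, AEMeasurable (fun ω => ENNReal.ofReal (f i ω)) P := fun i =>
    (hf i).aestronglyMeasurable.aemeasurable.ennreal_ofReal
  have h1 : ∫⁻ ω, ∑' i, ENNReal.ofReal (f i ω) ∂P ≠ ⊤ := by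
    rw [lintegral_tsum hm]
    refine ne_top_of_le_ne_top hc.tsum_ofReal_ne_top (ENNReal.tsum_le_tsum fun i => ?_)
    rw [← ofReal_integral_eq_lintegral_ofReal (hf i) (Eventually.of_forall (hf0 i))]
    exact ENNReal.ofReal_le_ofReal (h i)
  filter_upwards [ae_lt_top' (AEMeasurable.tsum hm) h1] with ω hω
  exact (ENNReal.summable_toReal hω.ne).congr fun i => ENNReal.toReal_ofReal (hf0 i ω)

lemma integrable_pow_four_gaussianReal (v : ℝ≥0) :
    Integrable (fun x : ℝ => x ^ 4) (gaussianReal 0 v) := by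
  have h := MemLp.integrable_norm_pow (p := 4) (memLp_id_gaussianReal (μ := 0) (v := v) 4)
    (by norm_num)
  refine h.congr (Eventually.of_forall fun x => ?_)
  simp only [id, Real.norm_eq_abs]
  exact Even.pow_abs (by decide) x

/-- Only the scaling in `v` matters; the numerical value of the standard fourth moment is never
needed. -/
lemma integral_pow_four_gaussianReal (v : ℝ≥0) :
    ∫ x, x ^ 4 ∂(gaussianReal 0 v) = v ^ 2 * ∫ x, x ^ 4 ∂(gaussianReal 0 1) := by
  have h : gaussianReal 0 v = (gaussianReal 0 1).map (fun x => √(v : ℝ) * x) := by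
    rw [gaussianReal_map_const_mul, mul_zero, mul_one]
    congr 1
    ext
    simp
  rw [h, integral_map (by fun_prop) (by fun_prop), ← integral_const_mul]
  congr 1
  ext x
  rw [mul_pow, show (4 : ℕ) = 2 * 2 from rfl, pow_mul, Real.sq_sqrt (NNReal.coe_nonneg v)]

lemma integrable_pow_four_of_hasLaw {X : Ω → ℝ} {v : ℝ≥0} (hX : HasLaw X (gaussianReal 0 v) P) :
    Integrable (fun ω => X ω ^ 4) P := by
  have h := integrable_pow_four_gaussianReal v
  rw [← hX.map_eq] at h
  exact (integrable_map_measure (by fun_prop) hX.aemeasurable).1 h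

lemma integral_pow_four_of_hasLaw {X : Ω → ℝ} {v : ℝ≥0} (hX : HasLaw X (gaussianReal 0 v) P) :
    ∫ ω, X ω ^ 4 ∂P = v ^ 2 * ∫ x, x ^ 4 ∂(gaussianReal 0 1) := by
  rw [← integral_pow_four_gaussianReal]
  exact hX.integral_comp (f := fun x => x ^ 4) (by fun_prop)

end Moments

/-! ### Shellwise bounds for the Wiener process. -/

section Wiener

/-- Finite trace: for each term of the nuclear expansion, Cauchy–Schwarz over the shells gives `∑
|a_j(n) b_j(n)| ≤ ‖a_j‖ ‖b_j‖`. Positivity of `Q` turns bounded partial sums into summability. -/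
lemma IsNuclear.summable_inner_basisVec {Q : H →L[ℝ] H} (hQ : Q.IsPositive) (hn : IsNuclear Q) :
    Summable fun n => ⟪Q (basisVec n), basisVec n⟫ := by
  obtain ⟨a, b, hab, hQab⟩ := hn
  have h1 : ∀ n, HasSum (fun j => a j n * b j n) ⟪Q (basisVec n), basisVec n⟫ := fun n => by
    have h := (hQab (basisVec n)).mapL (innerSL ℝ (basisVec n))
    simp only [innerSL_apply_apply, inner_smul_right, inner_basisVec] at h
    simp only [real_inner_comm _ (basisVec n), inner_basisVec] at h ⊢
    exact h
  refine summable_of_sum_range_le (c := ∑' j, ‖a j‖ * ‖b j‖)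
    (fun n => hQ.inner_nonneg_left (basisVec n)) fun N => ?_
  refine hasSum_le (fun j => ?_) (hasSum_sum fun n (_ : n ∈ Finset.range N) => h1 n) hab.hasSum
  refine (Real.sum_mul_le_sqrt_mul_sqrt _ _ _).trans ?_
  refine mul_le_mul ?_ ?_ (Real.sqrt_nonneg _) (norm_nonneg _) <;>
  exact Real.sqrt_le_iff.2 ⟨norm_nonneg _, sum_range_sq_le _ _⟩

variable {Ω : Type*} {mΩ : MeasurableSpace Ω} {P : Measure Ω}
  {ℱ : Filtration ℝ≥0 mΩ} {Q : H →L[ℝ] H} {W : ℝ≥0 → Ω → H}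

lemma IsQWiener.hasLaw_dyadic_increment (hW : IsQWiener P ℱ Q W) {T : ℝ} (hT : 0 < T)
    (n m j : ℕ) :
    HasLaw (fun ω => W (((j : ℝ) + 1) * (T / 2 ^ m)).toNNReal ω n -
      W ((j : ℝ) * (T / 2 ^ m)).toNNReal ω n)
      (gaussianReal 0 ((T / 2 ^ m).toNNReal * ⟪Q (basisVec n), basisVec n⟫.toNNReal)) P := by
  have h0 : 0 ≤ T / 2 ^ m := by positivity
  have h1 : (j : ℝ) * (T / 2 ^ m) ≤ ((j : ℝ) + 1) * (T / 2 ^ m) := by linarith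
  have h := hW.hasLaw _ _ (Real.toNNReal_le_toNNReal h1) (basisVec n)
  have e : (((j : ℝ) + 1) * (T / 2 ^ m)).toNNReal - ((j : ℝ) * (T / 2 ^ m)).toNNReal =
      (T / 2 ^ m).toNNReal := by
    rw [NNReal.sub_def, Real.coe_toNNReal _ (by positivity), Real.coe_toNNReal _ (by positivity)]
    congr 1
    ring
  rw [e] at h
  simpa only [inner_basisVec, H.sub_apply] using h

/-- Almost surely the shells of a Wiener process on `[0, T]` are dominated by a square summable
sequence. -/
lemma IsQWiener.ae_exists_summable_bound [IsProbabilityMeasure P]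
    (hW : IsQWiener P ℱ Q W) {T : ℝ} (hT : 0 < T) :
    ∀ᵐ ω ∂P, ∃ a : ℕ → ℝ, Summable a ∧
      ∀ s, 0 ≤ s → s ≤ T → ∀ n, W s.toNNReal ω n ^ 2 ≤ a n := by
  set C := ∫ x, x ^ 4 ∂(gaussianReal 0 1) with hC
  have hC0 : 0 ≤ C := integral_nonneg fun x => by positivity
  -- The geometric term keeps `q n` positive for division, even where the noise is degenerate, and
  -- preserves summability.
  set q : ℕ → ℝ := fun n => ⟪Q (basisVec n), basisVec n⟫ + (1 / 2) ^ n with hq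
  have hQ0 : ∀ n, 0 ≤ ⟪Q (basisVec n), basisVec n⟫ := fun n =>
    hW.isPositive.inner_nonneg_left (basisVec n)
  have hq0 : ∀ n, 0 < q n := fun n => add_pos_of_nonneg_of_pos (hQ0 n) (by positivity)
  have hqs : Summable q := (hW.isNuclear.summable_inner_basisVec hW.isPositive).add
    (summable_geometric_of_lt_one (by norm_num) (by norm_num))
  let Δ : ℕ → ℕ → ℕ → Ω → ℝ := fun n m j ω =>
    W (((j : ℝ) + 1) * (T / 2 ^ m)).toNNReal ω n - W ((j : ℝ) * (T / 2 ^ m)).toNNReal ω n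
  have hlaw : ∀ n m j, HasLaw (Δ n m j)
      (gaussianReal 0 ((T / 2 ^ m).toNNReal * ⟪Q (basisVec n), basisVec n⟫.toNNReal)) P :=
    fun n m j => hW.hasLaw_dyadic_increment hT n m j
  -- By `y² ≤ δ + y⁴/δ` with `δ = q n (3/4)^m`, this bounds every squared increment of level `m`.
  -- Second moments alone would not do: summed over the `2^m` increments they do not decay in `m`.
  let d : ℕ → ℕ → Ω → ℝ := fun n m ω =>
    q n * (3 / 4) ^ m + (∑ j ∈ Finset.range (2 ^ m), Δ n m j ω ^ 4) / (q n * (3 / 4) ^ m)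
  have hd0 : ∀ n m ω, 0 ≤ d n m ω := fun n m ω => by
    have := hq0 n
    positivity
  have hsumint : ∀ n m, Integrable (fun ω => ∑ j ∈ Finset.range (2 ^ m), Δ n m j ω ^ 4) P :=
    fun n m => integrable_finsetSum _ fun j _ => integrable_pow_four_of_hasLaw (hlaw n m j)
  have hdint : ∀ n m, Integrable (d n m) P := fun n m =>
    (integrable_const _).add ((hsumint n m).div_const _)
  -- The rates are `5/4 · 3/4 = 15/16` and `5/4 · 2 · (1/4) · (4/3) = 5/6`, both below `1`; one
  -- factor `q n` remains for summing over the shells.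
  have hdle : ∀ n m, ∫ ω, (5 / 4 : ℝ) ^ m * d n m ω ∂P ≤
      q n * ((15 / 16) ^ m + C * T ^ 2 * (5 / 6) ^ m) := by
    intro n m
    have hqn := hq0 n
    have h1 : ∫ ω, d n m ω ∂P = q n * (3 / 4) ^ m + (2 ^ m *
        (((T / 2 ^ m) * ⟪Q (basisVec n), basisVec n⟫) ^ 2 * C)) / (q n * (3 / 4) ^ m) := by
      have h2 : ∫ ω, d n m ω ∂P = ∫ _, q n * (3 / 4) ^ m ∂P +
          ∫ ω, (∑ j ∈ Finset.range (2 ^ m), Δ n m j ω ^ 4) / (q n * (3 / 4) ^ m) ∂P :=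
        integral_add (integrable_const _) ((hsumint n m).div_const _)
      rw [h2, integral_div, integral_finsetSum _
        fun j _ => integrable_pow_four_of_hasLaw (hlaw n m j)]
      simp only [integral_pow_four_of_hasLaw (hlaw n m _), Finset.sum_const, Finset.card_range]
      rw [NNReal.coe_mul, Real.coe_toNNReal _ (by positivity), Real.coe_toNNReal _ (hQ0 n)]
      simp [hC]
    have h3 : ((T / 2 ^ m) * ⟪Q (basisVec n), basisVec n⟫) ^ 2 ≤ ((T / 2 ^ m) * q n) ^ 2 := by
      have h4 : ⟪Q (basisVec n), basisVec n⟫ ≤ q n := le_add_of_nonneg_right (by positivity)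
      have := hQ0 n
      gcongr
    rw [integral_const_mul, h1]
    calc (5 / 4 : ℝ) ^ m * (q n * (3 / 4) ^ m + (2 ^ m *
          (((T / 2 ^ m) * ⟪Q (basisVec n), basisVec n⟫) ^ 2 * C)) / (q n * (3 / 4) ^ m))
        ≤ (5 / 4 : ℝ) ^ m * (q n * (3 / 4) ^ m + (2 ^ m *
          (((T / 2 ^ m) * q n) ^ 2 * C)) / (q n * (3 / 4) ^ m)) := by gcongr
      _ = q n * ((15 / 16) ^ m + C * T ^ 2 * (5 / 6) ^ m) := by
        have e1 : (15 / 16 : ℝ) ^ m = (5 / 4) ^ m * (3 / 4) ^ m := by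
          rw [← mul_pow]
          norm_num
        have e2 : (5 / 6 : ℝ) ^ m = (5 / 4) ^ m / (3 / 4) ^ m / 2 ^ m := by
          rw [← div_pow, ← div_pow]
          norm_num
        rw [e1, e2]
        generalize (5 / 4 : ℝ) ^ m = x
        have hy : (0 : ℝ) < (3 / 4) ^ m := by positivity
        have hz : (0 : ℝ) < 2 ^ m := by positivity
        generalize (3 / 4 : ℝ) ^ m = y at *
        generalize (2 : ℝ) ^ m = z at *
        field_simp
  have hcs : Summable fun p : ℕ × ℕ =>
      q p.1 * ((15 / 16) ^ p.2 + C * T ^ 2 * (5 / 6) ^ p.2) := by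
    refine Summable.mul_of_nonneg hqs (g := fun m : ℕ => (15 / 16 : ℝ) ^ m + C * T ^ 2 * (5 / 6) ^ m)
      ?_ (fun n => (hq0 n).le) (fun m => by positivity)
    exact (summable_geometric_of_lt_one (by norm_num) (by norm_num)).add
      ((summable_geometric_of_lt_one (by norm_num) (by norm_num)).mul_left _)
  have hae := ae_summable_of_integral_le (P := P)
    (f := fun (p : ℕ × ℕ) ω => (5 / 4 : ℝ) ^ p.2 * d p.1 p.2 ω)
    (fun p ω => mul_nonneg (by positivity) (hd0 _ _ _)) (fun p => (hdint _ _).const_mul _) hcs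
    fun p => hdle p.1 p.2
  filter_upwards [hae, hW.zero, hW.continuous] with ω hω h0 hcont
  refine ⟨fun n => 5 * ∑' m : ℕ, (5 / 4 : ℝ) ^ m * d n m ω, hω.prod.mul_left 5,
    fun s hs hsT n => ?_⟩
  refine sq_le_tsum_of_dyadic (x := fun s => W s.toNNReal ω n)
    ((continuous_apply n).comp (hcont.comp continuous_real_toNNReal)) (by simp [h0]) hT
    (fun m => hd0 n m ω) (hω.prod_factor n) (fun m j hj => ?_) hs hsT
  have hqn := hq0 n
  have h1 : Δ n m j ω ^ 4 ≤ ∑ j ∈ Finset.range (2 ^ m), Δ n m j ω ^ 4 :=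
    Finset.single_le_sum (f := fun j => Δ n m j ω ^ 4) (fun j _ => by positivity)
      (Finset.mem_range.2 hj)
  have hδ : 0 < q n * (3 / 4 : ℝ) ^ m := by positivity
  have h2 : Δ n m j ω ^ 2 ≤ q n * (3 / 4) ^ m + Δ n m j ω ^ 4 / (q n * (3 / 4) ^ m) := by
    generalize q n * (3 / 4 : ℝ) ^ m = δ at hδ
    generalize Δ n m j ω = y
    rw [← sub_le_iff_le_add', le_div_iff₀ hδ]
    nlinarith [sq_nonneg (y ^ 2 - δ), sq_nonneg y, sq_nonneg δ]
  exact h2.trans (add_le_add_right (div_le_div_of_nonneg_right h1 hδ.le) _)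

lemma IsQWiener.ae_isShellDominated [IsProbabilityMeasure P] (hW : IsQWiener P ℱ Q W) :
    ∀ᵐ ω ∂P, IsShellDominated fun s => W s.toNNReal ω := by
  have h : ∀ᵐ ω ∂P, ∀ N : ℕ, ∃ a : ℕ → ℝ, Summable a ∧
      ∀ s, 0 ≤ s → s ≤ (N + 1 : ℝ) → ∀ n, W s.toNNReal ω n ^ 2 ≤ a n :=
    ae_all_iff.2 fun N => hW.ae_exists_summable_bound (by positivity)
  filter_upwards [h] with ω hω T
  obtain ⟨a, ha, hb⟩ := hω ⌈T⌉₊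
  exact ⟨a, ha, fun s hs hsT n => hb s hs (by linarith [Nat.le_ceil T]) n⟩

end Wiener

/-! ### From shell equations to the weak formulation. -/

section WeakForm

variable {k₀ ν : ℝ}

/-- The factor `A^{1/2}` missing from `bil` is moved onto the test vector; antisymmetry of `B` then
gives the sign. -/
lemma inner_bil_sqrt_eq (u : H) (φ : V k₀) :
    ⟪bil u u, toH fun n => wave k₀ (n + 1) * (φ : H) n⟫ = -⟪opB k₀ u φ, u⟫ := by
  have hs : Summable fun n => (wave k₀ (n + 1) * (φ : H) n) ^ 2 :=
    Summable.congr φ.2 fun n => by ring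
  refine (hasSum_inner_mul _ _).unique ?_
  convert hasSum_Bseq_mul k₀ u u φ using 2 with n
  rw [toH_apply hs, bil_apply, Bseq_eq_wave_mul]
  ring

/-- The integral equation in every shell implies the weak formulation. -/
lemma weak_eq_of_shell_eq {U : ℝ → H} (hU : Continuous U) {u₀ w : H} {t : ℝ}
    (h : ∀ n, U t n = u₀ n - ν * wave k₀ (n + 1) ^ 2 * (∫ s in (0 : ℝ)..t, U s n) +
      wave k₀ (n + 1) * (∫ s in (0 : ℝ)..t, bil (U s) (U s) n) + w n) (φ : DA k₀) :
    ⟪U t, (φ : H)⟫ + ν * ∫ s in (0 : ℝ)..t, ⟪U s, opA k₀ φ⟫ =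
      ⟪u₀, (φ : H)⟫ - (∫ s in (0 : ℝ)..t,
        ⟪opB k₀ (U s) (Submodule.inclusion (DA_le_V k₀) φ), U s⟫) + ⟪w, (φ : H)⟫ := by
  have hs : Summable fun n => (wave k₀ (n + 1) * (φ : H) n) ^ 2 :=
    Summable.congr (DA_le_V k₀ φ.2) fun n => by ring
  have hb : Continuous fun s => bil (U s) (U s) := continuous_bil_self.comp hU
  -- Both sides are sums over `n` of the shell equation times `φ_n`, so termwise equality suffices.
  have h1 := (hasSum_inner_mul (U t) φ).add
    ((hasSum_integral_inner hU (opA k₀ φ) t).mul_left ν)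
  have h2 := ((hasSum_inner_mul u₀ φ).add (hasSum_integral_inner hb
    (toH fun n => wave k₀ (n + 1) * (φ : H) n) t)).add (hasSum_inner_mul w φ)
  have e : ∀ s, ⟪bil (U s) (U s), toH fun n => wave k₀ (n + 1) * (φ : H) n⟫ =
      -⟪opB k₀ (U s) (Submodule.inclusion (DA_le_V k₀) φ), U s⟫ := fun s =>
    inner_bil_sqrt_eq (U s) (Submodule.inclusion (DA_le_V k₀) φ)
  simp only [e, intervalIntegral.integral_neg] at h2
  rw [sub_eq_add_neg]
  refine h1.unique ?_
  convert h2 using 2 with n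
  have eA : opA k₀ φ n = wave k₀ (n + 1) ^ 2 * (φ : H) n := rfl
  rw [toH_apply hs, eA, h n]
  ring

end WeakForm

end

end DyadicShell

/-! ### Assembly of the adapted global solution. -/

open DyadicShell in
theorem mainTheorem1 {Ω : Type*} {mΩ : MeasurableSpace Ω} (P : Measure Ω) [IsProbabilityMeasure P]
    (ℱ : Filtration ℝ≥0 mΩ) (k₀ ν : ℝ) (hk₀ : 0 < k₀) (hν : 0 < ν)
    (Q : DyadicShell.H →L[ℝ] DyadicShell.H) (W : ℝ≥0 → Ω → DyadicShell.H)
    (hW : DyadicShell.IsQWiener P ℱ Q W)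
    (u₀ : Ω → DyadicShell.H) (hu₀ : Measurable[ℱ 0] u₀) :
    ∃ u : ℝ≥0 → Ω → DyadicShell.H,
      DyadicShell.IsGlobalWeakSolution P ℱ k₀ ν W u₀ u := by
  -- The good paths, a set of full measure that need not lie in any `ℱ t`.
  let G : Set Ω := {ω | W 0 ω = 0 ∧ (Continuous fun t => W t ω) ∧
    IsShellDominated fun s => W s.toNNReal ω}
  have hG : ∀ᵐ ω ∂P, ω ∈ G := by
    filter_upwards [hW.zero, hW.continuous, hW.ae_isShellDominated] with ω h1 h2 h3
    exact ⟨h1, h2, h3⟩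
  have hc : ∀ ω : G, Continuous fun s : ℝ => W s.toNNReal ω := fun ω =>
    ω.2.2.1.comp continuous_real_toNNReal
  have hval : ∀ {s t : ℝ≥0} {f : Ω → H}, s ≤ t → Measurable[ℱ s] f →
      StronglyMeasurable[(ℱ t).comap Subtype.val] fun ω : G => f ω := fun {s t f} hst hf =>
    stronglyMeasurable_of_apply (m := (ℱ t).comap Subtype.val) fun n =>
      ((continuous_apply n).measurable.comp (hf.mono (ℱ.mono hst) le_rfl)).comp
        (comap_measurable (m := ℱ t) Subtype.val)
  -- On `G` the solution is measurable for the trace of `ℱ t`, hence is the restriction of an `ℱ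
  -- t`-measurable map on `Ω`. No completeness of the filtration is used.
  have hext : ∀ t : ℝ≥0, ∃ h : Ω → H, StronglyMeasurable[ℱ t] h ∧
      (fun ω : G => shellSol k₀ ν (u₀ ω) (fun s => W s.toNNReal ω) t) = h ∘ Subtype.val := by
    intro t
    refine StronglyMeasurable.exists_eq_measurable_comp (mY := ℱ t) ?_
    refine stronglyMeasurable_shellSol (mΩ := (ℱ t).comap Subtype.val)
      (u₀ := fun ω : G => u₀ ω) (W := fun s (ω : G) => W s.toNNReal ω) hk₀ hν
      (hval zero_le hu₀) hc (fun ω => ω.2.2.2) (fun s hs hst => ?_) t.2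
    have hst' : s.toNNReal ≤ t := Real.toNNReal_le_iff_le_coe.2 hst
    exact hval hst' (hW.adapted s.toNNReal)
  choose u hum hu using hext
  have hu' : ∀ ω ∈ G, ∀ t : ℝ≥0, u t ω = shellSol k₀ ν (u₀ ω) (fun s => W s.toNNReal ω) t :=
    fun ω hω t => (congrFun (hu t) ⟨ω, hω⟩).symm
  refine ⟨u, fun T hT => ?_⟩
  have hsol := fun (ω : Ω) (hω : ω ∈ G) => exists_shellSol_eq
    (w := fun s => W s.toNNReal ω) hk₀ hν (hc ⟨ω, hω⟩) (by simpa using hω.1) hω.2.2 (u₀ ω) T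
  refine ⟨fun t _ => (hum t).measurable, ?_, ?_, ?_⟩
  · filter_upwards [hG] with ω hω
    obtain ⟨U, -, hU0, hUs, -⟩ := hsol ω hω
    rw [hu' ω hω, NNReal.coe_zero, hUs 0 le_rfl T.2, hU0]
  · filter_upwards [hG] with ω hω
    obtain ⟨U, hUc, -, hUs, -⟩ := hsol ω hω
    refine (hUc.comp NNReal.continuous_coe).continuousOn.congr fun t ht => ?_
    rw [hu' ω hω, hUs t t.2 (NNReal.coe_le_coe.2 ht.2)]
    rfl
  · filter_upwards [hG] with ω hω φ t ht
    obtain ⟨U, hUc, -, hUs, hUe⟩ := hsol ω hω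
    have htT : (t : ℝ) ≤ T := NNReal.coe_le_coe.2 ht
    have e : ∀ s ∈ Set.uIcc (0 : ℝ) t, u s.toNNReal ω = U s := fun s hs => by
      rw [Set.uIcc_of_le t.coe_nonneg] at hs
      rw [hu' ω hω, Real.coe_toNNReal s hs.1, hUs s hs.1 (hs.2.trans htT)]
    have et : u t ω = U t := by
      rw [hu' ω hω, hUs t t.2 htT]
    have h := weak_eq_of_shell_eq hUc (hUe t t.2 htT) φ
    rw [Real.toNNReal_coe] at h
    rw [et, intervalIntegral.integral_congr (g := fun s => ⟪U s, opA k₀ φ⟫)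
      fun s hs => by simp only [e s hs],
      intervalIntegral.integral_congr (f := fun s => ⟪opB k₀ (u s.toNNReal ω)
        (Submodule.inclusion (DA_le_V k₀) φ), u s.toNNReal ω⟫)
        (g := fun s => ⟪opB k₀ (U s) (Submodule.inclusion (DA_le_V k₀) φ), U s⟫)
      fun s hs => by simp only [e s hs]]
    exact h
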